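/- Notation: $\mathbb N=\{0,1,2,\dots\}$; for an integer $m\ge 1$, $I_m=\{(j,\alpha)\in\mathbb N^2 : j+\alpha\le m,\ j<m\}$; $[\rho]_0=1$ and $[\rho]_\beta=\rho(\rho-1)\cdots(\rho-\beta+1)$ for $\beta\ge1$. Let $c_{j,\alpha}\le 0$ be real numbers $((j,\alpha)\in I_m)$, and put $$L(\lambda,\rho)=\lambda^m-\sum_{(j,\alpha)\in I_m}c_{j,\alpha}\,\lambda^j[\rho]_\alpha .$$ The Newton polygon $\mathcal N_0\subset\mathbb R^2$ of $L$ is the convex hull of the union of the quadrants $\{(x,y) : x\le j,\ y\le\alpha\}$ over $(j,\alpha)\in\{(m,0)\}\cup\{(j,\alpha)\in I_m : c_{j,\alpha}\ne0\}$. For real $s,\sigma\ge1$, a formal series $\sum_{k,l\ge0}a_{k,l}t^kx^l\in\mathbb C[[t,x]]$ belongs to $G\{t,x\}_{(s,\sigma)}$ if the power series $\sum_{k,l}\frac{a_{k,l}}{k!^{\,s-1}\,l!^{\,\sigma-1}}t^kx^l$ converges in a neighbourhood of $(0,0)\in\mathbb C^2$. Let $A,B,C>0$; let $p,q,\mu\in\mathbb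 N$ with $p\ge1$, $q\ge1$, $0\le\mu<m$; let $(h,\beta)\in I_m$ with $(h,\beta)\notin\mathcal N_0$; let $(j,\alpha)\in I_m$ with $\alpha>\mu$. Set $d=\min\{y\in\mathbb R : (h,\beta-y)\in\mathcal N_0\}$ and $$\sigma_0^*=1+\frac dp,\qquad s_0^*=1+\max\Bigl[0,\ \frac{j+\alpha+(d/p)(\alpha-\mu)-m}{q}\Bigr].$$ (1) The equation $$L(t\partial_t,x\partial_x)u=Ax^mt+Bx^p(t\partial_t)^h[x\partial_x]_\beta u+Ct^qx^\mu(t\partial_t)^j\partial_x^\alpha u$$ has a unique formal solution $u(t,x)\in\mathbb C[[t,x]]$ with $u(0,x)\equiv0$, and for all real $s\ge1$, $\sigma\ge1$ one has $u\in G\{t,x\}_{(s,\sigma)}$ if and only if $s\ge s_0^*$ and $\sigma\ge\sigma_0^*$. (2) The same holds, with the same $s_0^*$ and $\sigma_0^*$, for the equation $$L(t\partial_t,x\partial_x)u=Axt+Bx^p(t\partial_t)^h(x\partial_x)^\beta u+Ct^qx^\mu(t\partial_t)^j\partial_x^\alpha u .$$ -/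

import Mathlib

open scoped Topology Nat

noncomputable section

namespace FormalGevrey

/-- The ring `ℂ[[t, x]]` of formal power series; index `0` is the variable `t`, index `1` is `x`. -/
abbrev Series : Type := MvPowerSeries (Fin 2) ℂ

/-- The exponent of the monomial `t ^ k * x ^ l`. -/
def expo (k l : ℕ) : Fin 2 →₀ ℕ := Finsupp.single 0 k + Finsupp.single 1 l

/-- The coefficient of `t ^ k * x ^ l` in `u`. -/
def cf (u : Series) (k l : ℕ) : ℂ := MvPowerSeries.coeff (expo k l) u

/-- The variable `t` as a formal series. -/
def tvar : Series := MvPowerSeries.X 0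

/-- The variable `x` as a formal series. -/
def xvar : Series := MvPowerSeries.X 1

/-- The operator `∂_t`. -/
def dt : Module.End ℂ Series := (MvPowerSeries.pderiv ℂ (0 : Fin 2)).toLinearMap

/-- The operator `∂_x`. -/
def dx : Module.End ℂ Series := (MvPowerSeries.pderiv ℂ (1 : Fin 2)).toLinearMap

/-- The operator `t ∂_t`. -/
def thetaT : Module.End ℂ Series := LinearMap.mulLeft ℂ tvar * dt

/-- The operator `x ∂_x`. -/
def thetaX : Module.End ℂ Series := LinearMap.mulLeft ℂ xvar * dx

/-- The operator `[x ∂_x]_b = (x ∂_x) (x ∂_x - 1) ⋯ (x ∂_x - b + 1)`, with `[x ∂_x]_0 = 1`. -/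
def fallX (b : ℕ) : Module.End ℂ Series := Polynomial.aeval thetaX (descPochhammer ℂ b)

/-- The index set `I_m` of the pairs `(j, a)` with `j + a ≤ m` and `j < m`. -/
def Im (m : ℕ) : Finset (ℕ × ℕ) :=
  (Finset.range m ×ˢ Finset.range (m + 1)).filter fun v => v.1 + v.2 ≤ m

/-- The operator `L(t ∂_t, x ∂_x)`, where
`L(X, Y) = X ^ m - ∑_{(j, a) ∈ I_m} c (j, a) X ^ j Y (Y - 1) ⋯ (Y - a + 1)`. -/
def opL (m : ℕ) (c : ℕ × ℕ → ℝ) : Module.End ℂ Series :=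
  thetaT ^ m - ∑ v ∈ Im m, (c v : ℂ) • (thetaT ^ v.1 * fallX v.2)

/-- The set `Λ₀`: the pair `(m, 0)` and the pairs of `I_m` with non-zero coefficient. -/
def Lam0 (m : ℕ) (c : ℕ × ℕ → ℝ) : Set (ℕ × ℕ) :=
  {(m, 0)} ∪ {v | v ∈ Im m ∧ c v ≠ 0}

/-- The Newton polygon of `L`: the convex hull in `ℝ²` of the union of the quadrants
`{(x, y) | x ≤ j, y ≤ a}`, where `(j, a)` runs through `Λ₀`. -/
def newtonPolygon (m : ℕ) (c : ℕ × ℕ → ℝ) : Set (ℝ × ℝ) :=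
  convexHull ℝ (⋃ v ∈ Lam0 m c, {z : ℝ × ℝ | z.1 ≤ (v.1 : ℝ) ∧ z.2 ≤ (v.2 : ℝ)})

/-- The number `d = min {y ∈ ℝ | (h, b - y) ∈ N₀}`, where `N₀` is the Newton polygon. -/
def height (m : ℕ) (c : ℕ × ℕ → ℝ) (h b : ℕ) : ℝ :=
  sInf {y : ℝ | ((h : ℝ), (b : ℝ) - y) ∈ newtonPolygon m c}

open scoped Pointwise in
/-- The infimum in the definition of `height` is a minimum. -/
theorem isLeast_height (m : ℕ) (c : ℕ × ℕ → ℝ) (h b : ℕ) (hh : h ≤ m) :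
    IsLeast {y : ℝ | ((h : ℝ), (b : ℝ) - y) ∈ newtonPolygon m c} (height m c h b) := by
  have hfin : (Lam0 m c).Finite :=
    (Set.finite_singleton _).union ((Im m).finite_toSet.subset fun v hv => hv.1)
  set f : ℕ × ℕ → ℝ × ℝ := fun v => ((v.1 : ℝ), (v.2 : ℝ)) with hf
  have hU : (⋃ v ∈ Lam0 m c, {z : ℝ × ℝ | z.1 ≤ (v.1 : ℝ) ∧ z.2 ≤ (v.2 : ℝ)})
      = f '' Lam0 m c + Set.Iic (0 : ℝ × ℝ) := by
    ext z
    simp only [Set.mem_iUnion, Set.mem_ofPred_eq, Set.mem_add, Set.mem_image, Set.mem_Iic]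
    constructor
    · rintro ⟨v, hv, h1, h2⟩
      refine ⟨f v, ⟨v, hv, rfl⟩, z - f v, ?_, by abel⟩
      exact ⟨by simpa [hf] using h1, by simpa [hf] using h2⟩
    · rintro ⟨_, ⟨v, hv, rfl⟩, w, ⟨h1, h2⟩, rfl⟩
      refine ⟨v, hv, ?_, ?_⟩
      · simpa [hf] using h1
      · simpa [hf] using h2
  have hclosed : IsClosed (newtonPolygon m c) := by
    rw [newtonPolygon, hU, convexHull_add, (convex_Iic (0 : ℝ × ℝ)).convexHull_eq]
    exact isClosed_Iic.add_left_of_isCompact ((hfin.image f).isCompact_convexHull ℝ)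
  have hle : newtonPolygon m c ⊆ {z : ℝ × ℝ | z.2 ≤ (m : ℝ)} := by
    refine convexHull_min ?_ (convex_halfSpace_le (LinearMap.snd ℝ ℝ ℝ).isLinear _)
    intro z hz
    simp only [Set.mem_iUnion, Set.mem_ofPred_eq] at hz ⊢
    obtain ⟨v, hv, -, h2⟩ := hz
    refine h2.trans ?_
    rcases hv with rfl | ⟨hv, -⟩
    · simp
    · simp only [Im, Finset.mem_filter] at hv
      exact_mod_cast (by omega : v.2 ≤ m)
  have hne : ((b : ℝ)) ∈ {y : ℝ | ((h : ℝ), (b : ℝ) - y) ∈ newtonPolygon m c} := by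
    refine subset_convexHull ℝ _ ?_
    simp only [Set.mem_iUnion, Set.mem_ofPred_eq]
    refine ⟨(m, 0), Or.inl rfl, ?_, by simp⟩
    exact_mod_cast hh
  have hbdd : BddBelow {y : ℝ | ((h : ℝ), (b : ℝ) - y) ∈ newtonPolygon m c} := by
    refine ⟨(b : ℝ) - m, fun y hy => ?_⟩
    have := hle hy
    simp only [Set.mem_ofPred_eq] at this
    linarith
  refine ⟨IsClosed.csInf_mem ?_ ⟨_, hne⟩ hbdd, fun y hy => csInf_le hbdd hy⟩
  exact hclosed.preimage (by fun_prop : Continuous fun y : ℝ => ((h : ℝ), (b : ℝ) - y))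

/-- The formal Gevrey class `G{t, x}_{(s, σ)}` (for `s ≥ 1`, `σ ≥ 1`): the power series
`∑ u_{k,l} / (k!^(s-1) l!^(σ-1)) t^k x^l` converges in a neighbourhood of `(0, 0)` in `ℂ²`. -/
def InGevrey (s σ : ℝ) (u : Series) : Prop :=
  ∀ᶠ z : ℂ × ℂ in 𝓝 0, Summable fun n : ℕ × ℕ =>
    cf u n.1 n.2 / (((((n.1)! : ℝ) ^ (s - 1) * ((n.2)! : ℝ) ^ (σ - 1) : ℝ)) : ℂ)
      * z.1 ^ n.1 * z.2 ^ n.2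

/-- The right-hand side
`A x^m t + B x^p (t ∂_t)^h [x ∂_x]_β u + C t^q x^μ (t ∂_t)^j ∂_x^α u`. -/
def modelRhs (m : ℕ) (A B C : ℝ) (p q μ h β j α : ℕ) (u : Series) : Series :=
  (A : ℂ) • (xvar ^ m * tvar)
    + (B : ℂ) • (xvar ^ p * (thetaT ^ h * fallX β) u)
    + (C : ℂ) • (tvar ^ q * xvar ^ μ * (thetaT ^ j * dx ^ α) u)

/-- The right-hand side
`A x t + B x^p (t ∂_t)^h (x ∂_x)^β u + C t^q x^μ (t ∂_t)^j ∂_x^α u`. -/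
def variantRhs (A B C : ℝ) (p q μ h β j α : ℕ) (u : Series) : Series :=
  (A : ℂ) • (xvar * tvar)
    + (B : ℂ) • (xvar ^ p * (thetaT ^ h * thetaX ^ β) u)
    + (C : ℂ) • (tvar ^ q * xvar ^ μ * (thetaT ^ j * dx ^ α) u)

/-- `u` is a formal solution of `L(t ∂_t, x ∂_x) u = rhs u` with `u(0, x) ≡ 0`. -/
def IsFormalSolution (m : ℕ) (c : ℕ × ℕ → ℝ) (rhs : Series → Series) (u : Series) : Prop :=
  (∀ l : ℕ, cf u 0 l = 0) ∧ opL m c u = rhs u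

/-- The index `σ₀* = 1 + d / p`. -/
def sigmaStar (m : ℕ) (c : ℕ × ℕ → ℝ) (p h β : ℕ) : ℝ :=
  1 + height m c h β / p

/-- The index `s₀* = 1 + max [0, (j + α + (d / p) (α - μ) - m) / q]`. -/
def sStar (m : ℕ) (c : ℕ × ℕ → ℝ) (p q μ h β j α : ℕ) : ℝ :=
  1 + max 0 (((j : ℝ) + α + height m c h β / p * ((α : ℝ) - μ) - m) / q)

end FormalGevrey

end

open scoped Topology Nat

noncomputable section

namespace FormalGevrey

/-! Write δ = α - μ, e = d/p and u = ∑ u_{k,l} t^k x^l. Comparing coefficients, L(k,l) u_{k,l} is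
the sum of the source, of B k^h g(l-p) u_{k,l-p} (an "x-step" from l-p to l) and of C (k-q)^j
[l+δ]_α u_{k-q,l+δ} (a "t-step": k rises by q, l drops by δ). Since all c are ≤ 0, L(k,l) ≥ k^m > 0
for k ≥ 1. Hence the formal solution exists, is unique and has non-negative coefficients. Nothing
cancels, so a single path through the recurrence already yields a lower bound.

Upper bound (`exists_sol_le`). As (h, β-d) lies in the Newton polygon, k^h l^β ≤ K l^d L(k,l), so
x-steps together cost at most about l!^e. A t-step costs k^j l^α, plus l^{eδ} because it starts from
l+δ, in total k^j l^E with E = α + eδ, and gains L ≥ (k+q)^m. Powers of l are not controlled by k,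
so the majorant `weight` carries a power of (l+1)⋯(l+αk). This product absorbs l^E at every t-step
and in the end is at most c^{k+l} k!^α.

Lower bound (`exists_lower_bounds`). A supporting line of the polygon at (h, β-d) has slope -κ with
0 ≤ κ < 1. On the curve k ~ r^κ, l ~ r, the symbol is O(r^{κh+β-d}), so an x-step gains a full
factor r^d there. Reaching k ~ r^κ takes only O(r^κ) steps, whose total cost r^{O(r^κ)} is merely
geometric in r because κ < 1. Next δr x-steps produce r^{dδr} at l ~ pδr, which forces σ - 1 ≥ d/p.
Then pr t-steps bring l back and multiply by r^{p(j+α-m)r} at k ~ qpr, which forces q(s-1) ≥ j + α +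
eδ - m. -/

/-! ### Action of the operators on coefficients. -/

theorem exists_expo_eq (n : Fin 2 →₀ ℕ) : expo (n 0) (n 1) = n := by
  ext i
  fin_cases i <;> simp [expo]

theorem expo_injective {k l k' l' : ℕ} : expo k l = expo k' l' ↔ k = k' ∧ l = l' := by
  constructor
  · intro h
    have h0 := DFunLike.congr_fun h 0
    have h1 := DFunLike.congr_fun h 1
    simp [expo] at h0 h1
    exact ⟨h0, h1⟩
  · rintro ⟨rfl, rfl⟩
    rfl

theorem series_ext {u v : Series} (h : ∀ k l, cf u k l = cf v k l) : u = v := by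
  ext n
  rw [← exists_expo_eq n]
  exact h _ _

theorem cf_add (u v : Series) (k l : ℕ) : cf (u + v) k l = cf u k l + cf v k l := map_add _ _ _

theorem cf_smul (a : ℂ) (u : Series) (k l : ℕ) : cf (a • u) k l = a * cf u k l := by
  simp [cf]

theorem cf_mulX0_pow (q : ℕ) (u : Series) (k l : ℕ) :
    cf (tvar ^ q * u) k l = if q ≤ k then cf u (k - q) l else 0 := by
  have hle : Finsupp.single 0 q ≤ expo k l ↔ q ≤ k := by
    rw [Finsupp.single_le_iff]
    simp [expo]
  have hsub : expo k l - Finsupp.single 0 q = expo (k - q) l := by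
    ext i
    fin_cases i <;> simp [expo]
  rw [cf, tvar, MvPowerSeries.X_pow_eq, MvPowerSeries.coeff_monomial_mul, hsub]
  simp only [hle, one_mul, cf]

theorem cf_mulX1_pow (p : ℕ) (u : Series) (k l : ℕ) :
    cf (xvar ^ p * u) k l = if p ≤ l then cf u k (l - p) else 0 := by
  have hle : Finsupp.single 1 p ≤ expo k l ↔ p ≤ l := by
    rw [Finsupp.single_le_iff]
    simp [expo]
  have hsub : expo k l - Finsupp.single 1 p = expo k (l - p) := by
    ext i
    fin_cases i <;> simp [expo]
  rw [cf, xvar, MvPowerSeries.X_pow_eq, MvPowerSeries.coeff_monomial_mul, hsub]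
  simp only [hle, one_mul, cf]

theorem cf_source (a k l : ℕ) :
    cf (xvar ^ a * tvar) k l = if k = 1 ∧ l = a then 1 else 0 := by
  have h : (xvar ^ a * tvar : Series) = MvPowerSeries.monomial (expo 1 a) (1 : ℂ) := by
    rw [xvar, tvar, MvPowerSeries.X_pow_eq, MvPowerSeries.X, MvPowerSeries.monomial_mul_monomial,
      expo, add_comm, one_mul]
  rw [h, cf, MvPowerSeries.coeff_monomial]
  simp only [expo_injective]

theorem cf_dx (u : Series) (k l : ℕ) : cf (dx u) k l = (l + 1) * cf u k (l + 1) := by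
  have h : expo k l + Finsupp.single 1 1 = expo k (l + 1) := by
    simp [expo, add_assoc, ← Finsupp.single_add]
  have h1 : (expo k l) 1 = l := by simp [expo]
  have := MvPowerSeries.coeff_pderiv (R := ℂ) (i := (1 : Fin 2)) u (expo k l)
  rw [h, h1] at this
  rw [cf, dx, cf, mul_comm]
  exact this

theorem cf_dt (u : Series) (k l : ℕ) : cf (dt u) k l = (k + 1) * cf u (k + 1) l := by
  have h : expo k l + Finsupp.single 0 1 = expo (k + 1) l := by
    simp only [expo, Finsupp.single_add]
    abel
  have h1 : (expo k l) 0 = k := by simp [expo]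
  have := MvPowerSeries.coeff_pderiv (R := ℂ) (i := (0 : Fin 2)) u (expo k l)
  rw [h, h1] at this
  rw [cf, dt, cf, mul_comm]
  exact this

theorem cf_thetaT (u : Series) (k l : ℕ) : cf (thetaT u) k l = k * cf u k l := by
  have h : thetaT u = tvar ^ 1 * dt u := by simp [thetaT]
  rw [h, cf_mulX0_pow]
  rcases k with - | k
  · simp
  · simp [cf_dt]

theorem cf_thetaX (u : Series) (k l : ℕ) : cf (thetaX u) k l = l * cf u k l := by
  have h : thetaX u = xvar ^ 1 * dx u := by simp [thetaX]
  rw [h, cf_mulX1_pow]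
  rcases l with - | l
  · simp
  · simp [cf_dx]

theorem cf_thetaT_pow (n : ℕ) (u : Series) (k l : ℕ) :
    cf ((thetaT ^ n) u) k l = (k : ℂ) ^ n * cf u k l := by
  induction n with
  | zero => simp
  | succ n ih => rw [pow_succ', Module.End.mul_apply, cf_thetaT, ih]; ring

theorem cf_thetaX_pow (n : ℕ) (u : Series) (k l : ℕ) :
    cf ((thetaX ^ n) u) k l = (l : ℂ) ^ n * cf u k l := by
  induction n with
  | zero => simp
  | succ n ih => rw [pow_succ', Module.End.mul_apply, cf_thetaX, ih]; ring

theorem cf_aeval_thetaX (P : Polynomial ℂ) (u : Series) (k l : ℕ) :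
    cf (Polynomial.aeval thetaX P u) k l = P.eval (l : ℂ) * cf u k l := by
  induction P using Polynomial.induction_on' with
  | add P Q hP hQ => rw [map_add, LinearMap.add_apply, cf_add, hP, hQ, Polynomial.eval_add]; ring
  | monomial n a =>
    rw [Polynomial.aeval_monomial, Module.End.mul_apply, Module.algebraMap_end_apply, cf_smul,
      cf_thetaX_pow, Polynomial.eval_monomial]
    ring

theorem cf_fallX (b : ℕ) (u : Series) (k l : ℕ) :
    cf (fallX b u) k l = (l.descFactorial b : ℂ) * cf u k l := by
  rw [fallX, cf_aeval_thetaX, descPochhammer_eval_eq_descFactorial]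

theorem cf_dx_pow (a : ℕ) (u : Series) (k l : ℕ) :
    cf ((dx ^ a) u) k l = ((l + a).descFactorial a : ℂ) * cf u k (l + a) := by
  induction a generalizing l with
  | zero => simp
  | succ a ih =>
    rw [pow_succ', Module.End.mul_apply, cf_dx, ih]
    have h : (l + (a + 1)).descFactorial (a + 1) = (l + 1) * (l + 1 + a).descFactorial a := by
      rw [show l + (a + 1) = l + 1 + a by ring, Nat.descFactorial_succ]
      congr 1
      omega
    rw [h, show l + (a + 1) = l + 1 + a by ring]
    push_cast
    ring

/-- The value `L(k, l)` of the polynomial `L` at a pair of natural numbers. -/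
def symbolL (m : ℕ) (c : ℕ × ℕ → ℝ) (k l : ℕ) : ℝ :=
  (k : ℝ) ^ m - ∑ v ∈ Im m, c v * ((k : ℝ) ^ v.1 * (l.descFactorial v.2 : ℝ))

theorem cf_opL (m : ℕ) (c : ℕ × ℕ → ℝ) (u : Series) (k l : ℕ) :
    cf (opL m c u) k l = (symbolL m c k l : ℂ) * cf u k l := by
  have hsum : cf ((∑ v ∈ Im m, (c v : ℂ) • (thetaT ^ v.1 * fallX v.2)) u) k l
      = ∑ v ∈ Im m, (c v : ℂ) * ((k : ℂ) ^ v.1 * (l.descFactorial v.2 : ℂ)) * cf u k l := by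
    rw [LinearMap.sum_apply, cf, map_sum]
    refine Finset.sum_congr rfl fun v _ => ?_
    rw [LinearMap.smul_apply, Module.End.mul_apply]
    change cf _ k l = _
    rw [cf_smul, cf_thetaT_pow, cf_fallX]
    ring
  have hsub : cf (opL m c u) k l = cf ((thetaT ^ m) u) k l
      - cf ((∑ v ∈ Im m, (c v : ℂ) • (thetaT ^ v.1 * fallX v.2)) u) k l := by
    rw [opL, LinearMap.sub_apply]
    exact map_sub _ _ _
  rw [hsub, hsum, cf_thetaT_pow, symbolL, ← Finset.sum_mul]
  push_cast
  ring

theorem cf_shift_thetaT_fallX (p h β : ℕ) (u : Series) (k l : ℕ) :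
    cf (xvar ^ p * (thetaT ^ h * fallX β) u) k l =
      if p ≤ l then (k : ℂ) ^ h * ((l - p).descFactorial β : ℂ) * cf u k (l - p) else 0 := by
  rw [cf_mulX1_pow, Module.End.mul_apply, cf_thetaT_pow, cf_fallX, mul_assoc]

theorem cf_shift_thetaT_thetaX (p h β : ℕ) (u : Series) (k l : ℕ) :
    cf (xvar ^ p * (thetaT ^ h * thetaX ^ β) u) k l =
      if p ≤ l then (k : ℂ) ^ h * ((l - p : ℕ) : ℂ) ^ β * cf u k (l - p) else 0 := by
  rw [cf_mulX1_pow, Module.End.mul_apply, cf_thetaT_pow, cf_thetaX_pow, mul_assoc]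

theorem cf_shift_thetaT_dx (q μ j α : ℕ) (u : Series) (k l : ℕ) :
    cf (tvar ^ q * xvar ^ μ * (thetaT ^ j * dx ^ α) u) k l =
      if q ≤ k ∧ μ ≤ l then ((k - q : ℕ) : ℂ) ^ j * ((l - μ + α).descFactorial α : ℂ)
        * cf u (k - q) (l - μ + α) else 0 := by
  rw [mul_assoc, cf_mulX0_pow, cf_mulX1_pow, Module.End.mul_apply, cf_thetaT_pow, cf_dx_pow]
  by_cases h1 : q ≤ k <;> by_cases h2 : μ ≤ l <;> simp [h1, h2, mul_assoc]

theorem mem_Im {m j a : ℕ} : (j, a) ∈ Im m ↔ j < m ∧ j + a ≤ m := by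
  simp only [Im, Finset.mem_filter, Finset.mem_product, Finset.mem_range]
  omega

/-! ### The coefficient recurrence and its unique solution. -/

/-- The data of a model equation, described on the level of coefficients. The function `g` gives
the action of the operator in `x ∂_x` (a falling or an ordinary power), and the source term is
`A t x ^ l₀`. -/
structure Model where
  (m p q μ h β j α l₀ : ℕ)
  c : ℕ × ℕ → ℝ
  (A B C : ℝ)
  g : ℕ → ℝ
  c_nonpos : ∀ v ∈ Im m, c v ≤ 0
  A_pos : 0 < A
  B_pos : 0 < B
  C_pos : 0 < C
  p_pos : 1 ≤ p
  q_pos : 1 ≤ q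
  μ_lt : μ < m
  hβ_mem : (h, β) ∈ Im m
  not_mem : ((h : ℝ), (β : ℝ)) ∉ newtonPolygon m c
  jα_mem : (j, α) ∈ Im m
  μ_lt_α : μ < α
  descFactorial_le_g : ∀ l, (l.descFactorial β : ℝ) ≤ g l
  g_le_pow : ∀ l, g l ≤ (l : ℝ) ^ β
  exists_reach : ∃ r, m ≤ l₀ + p * r ∧ ∀ i < r, 0 < g (l₀ + p * i)

namespace Model

variable (D : Model)

/-- The value of the symbol of `L` at `(k, l)`. -/
abbrev sym (k l : ℕ) : ℝ := symbolL D.m D.c k l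

/-- The number `d`. -/
abbrev d : ℝ := height D.m D.c D.h D.β

/-- The number `α - μ`. -/
abbrev δ : ℕ := D.α - D.μ

theorem m_pos : 1 ≤ D.m := by have := D.μ_lt; omega

theorem δ_pos : 1 ≤ D.δ := by have := D.μ_lt_α; unfold δ; omega

theorem δ_add : D.δ + D.μ = D.α := by have := D.μ_lt_α; unfold δ; omega

theorem g_nonneg (l : ℕ) : 0 ≤ D.g l := le_trans (by positivity) (D.descFactorial_le_g l)

theorem term_nonneg {v : ℕ × ℕ} (hv : v ∈ Im D.m) (k l : ℕ) :
    0 ≤ -D.c v * ((k : ℝ) ^ v.1 * (l.descFactorial v.2 : ℝ)) :=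
  mul_nonneg (neg_nonneg.2 (D.c_nonpos v hv)) (by positivity)

theorem sym_eq (k l : ℕ) : D.sym k l = (k : ℝ) ^ D.m
    + ∑ v ∈ Im D.m, -D.c v * ((k : ℝ) ^ v.1 * (l.descFactorial v.2 : ℝ)) := by
  rw [sym, symbolL, sub_eq_add_neg, ← Finset.sum_neg_distrib]
  simp only [neg_mul]

theorem pow_le_sym (k l : ℕ) : (k : ℝ) ^ D.m ≤ D.sym k l := by
  rw [sym_eq]
  exact le_add_of_nonneg_right (Finset.sum_nonneg fun v hv => D.term_nonneg hv k l)

theorem term_le_sym {v : ℕ × ℕ} (hv : v ∈ Im D.m) (k l : ℕ) :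
    -D.c v * ((k : ℝ) ^ v.1 * (l.descFactorial v.2 : ℝ)) ≤ D.sym k l := by
  rw [sym_eq]
  have := Finset.single_le_sum (fun v hv => D.term_nonneg hv k l) hv
  have h2 : (0 : ℝ) ≤ (k : ℝ) ^ D.m := by positivity
  linarith

theorem sym_pos {k : ℕ} (hk : 1 ≤ k) (l : ℕ) : 0 < D.sym k l :=
  lt_of_lt_of_le (pow_pos (by exact_mod_cast hk) _) (D.pow_le_sym k l)

/-- The coefficients of the right-hand side of the equation. -/
def rhsCoeff (w : ℕ → ℕ → ℂ) (k l : ℕ) : ℂ :=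
  (if k = 1 ∧ l = D.l₀ then (D.A : ℂ) else 0)
    + (if D.p ≤ l then (D.B : ℂ) * ((k : ℂ) ^ D.h * (D.g (l - D.p) : ℂ) * w k (l - D.p)) else 0)
    + (if D.q ≤ k ∧ D.μ ≤ l then (D.C : ℂ) * (((k - D.q : ℕ) : ℂ) ^ D.j
        * ((l - D.μ + D.α).descFactorial D.α : ℂ) * w (k - D.q) (l - D.μ + D.α)) else 0)

/-- The coefficients of the formal solution. -/
def sol : ℕ → ℕ → ℝ
  | 0, _ => 0
  | k + 1, l =>
    ((if k + 1 = 1 ∧ l = D.l₀ then D.A else 0)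
      + (if _hl : D.p ≤ l then
          D.B * (((k + 1 : ℕ) : ℝ) ^ D.h * D.g (l - D.p) * sol (k + 1) (l - D.p)) else 0)
      + (if _hk : D.q ≤ k + 1 ∧ D.μ ≤ l then D.C * (((k + 1 - D.q : ℕ) : ℝ) ^ D.j
          * ((l - D.μ + D.α).descFactorial D.α : ℝ) * sol (k + 1 - D.q) (l - D.μ + D.α)) else 0))
      / D.sym (k + 1) l
-- The order must be lexicographic with k first: the x-term keeps k and lowers l, while the t-term
-- raises l but lowers k.
termination_by k l => (k, l)
decreasing_by
  · have := D.p_pos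
    exact Prod.Lex.right _ (by omega)
  · have := D.q_pos
    exact Prod.Lex.left _ _ (by omega)

theorem sol_zero (l : ℕ) : D.sol 0 l = 0 := by rw [sol]

theorem sym_mul_sol {k : ℕ} (hk : 1 ≤ k) (l : ℕ) :
    D.sym k l * D.sol k l = (if k = 1 ∧ l = D.l₀ then D.A else 0)
      + (if D.p ≤ l then D.B * ((k : ℝ) ^ D.h * D.g (l - D.p) * D.sol k (l - D.p)) else 0)
      + (if D.q ≤ k ∧ D.μ ≤ l then D.C * (((k - D.q : ℕ) : ℝ) ^ D.j
          * ((l - D.μ + D.α).descFactorial D.α : ℝ) * D.sol (k - D.q) (l - D.μ + D.α)) else 0) := by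
  obtain ⟨k, rfl⟩ : ∃ k', k = k' + 1 := ⟨k - 1, by omega⟩
  conv_lhs => rw [sol]
  rw [mul_div_cancel₀ _ (D.sym_pos hk l).ne']
  simp only [dite_eq_ite]

/-- Induction along the recurrence. -/
theorem recurrence_induction {P : ℕ → ℕ → Prop} (h0 : ∀ l, P 0 l)
    (hstep : ∀ k l, 1 ≤ k → (D.p ≤ l → P k (l - D.p)) →
      (D.q ≤ k → D.μ ≤ l → P (k - D.q) (l - D.μ + D.α)) → P k l) (k l : ℕ) : P k l := by
  have hp := D.p_pos
  have hq := D.q_pos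
  induction k using Nat.strong_induction_on generalizing l with
  | _ k ihk =>
    induction l using Nat.strong_induction_on with
    | _ l ihl =>
      rcases Nat.eq_zero_or_pos k with rfl | hk
      · exact h0 l
      · exact hstep k l hk (fun hl => ihl _ (by omega)) (fun hqk _ => ihk _ (by omega) _)

theorem sol_nonneg (k l : ℕ) : 0 ≤ D.sol k l := by
  refine D.recurrence_induction (P := fun k l => 0 ≤ D.sol k l) (fun l => (D.sol_zero l).ge)
    (fun k l hk hB hC => ?_) k l
  refine nonneg_of_mul_nonneg_right (a := D.sym k l) ?_ (D.sym_pos hk l)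
  rw [D.sym_mul_sol hk]
  have hA := D.A_pos
  have hB' := D.B_pos
  have hC' := D.C_pos
  refine add_nonneg (add_nonneg ?_ ?_) ?_
  · split_ifs <;> positivity
  · split_ifs with hl
    · have := hB hl
      have := D.g_nonneg (l - D.p)
      positivity
    · rfl
  · split_ifs with hl
    · have := hC hl.1 hl.2
      positivity
    · rfl

/-- A lower bound from the term in `B`. -/
theorem sol_step_x {k l : ℕ} (hk : 1 ≤ k) :
    D.B * ((k : ℝ) ^ D.h * D.g l * D.sol k l) ≤ D.sym k (l + D.p) * D.sol k (l + D.p) := by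
  rw [D.sym_mul_sol hk, if_pos (Nat.le_add_left _ _), Nat.add_sub_cancel]
  have h1 : 0 ≤ (if k = 1 ∧ l + D.p = D.l₀ then D.A else 0) := by
    have := D.A_pos
    split_ifs <;> positivity
  have h2 : 0 ≤ (if D.q ≤ k ∧ D.μ ≤ l + D.p then D.C * (((k - D.q : ℕ) : ℝ) ^ D.j
      * ((l + D.p - D.μ + D.α).descFactorial D.α : ℝ)
      * D.sol (k - D.q) (l + D.p - D.μ + D.α)) else 0) := by
    have := D.C_pos
    have := D.sol_nonneg (k - D.q) (l + D.p - D.μ + D.α)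
    split_ifs <;> positivity
  linarith

/-- A lower bound from the term in `C`. -/
theorem sol_step_t {k l : ℕ} (hl : D.μ ≤ l) :
    D.C * ((k : ℝ) ^ D.j * ((l + D.δ).descFactorial D.α : ℝ) * D.sol k (l + D.δ))
      ≤ D.sym (k + D.q) l * D.sol (k + D.q) l := by
  have hq := D.q_pos
  have hδ := D.δ_add
  rw [D.sym_mul_sol (by omega), if_pos (c := D.q ≤ k + D.q ∧ D.μ ≤ l) ⟨Nat.le_add_left _ _, hl⟩,
    Nat.add_sub_cancel, show l - D.μ + D.α = l + D.δ by omega]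
  have h1 : 0 ≤ (if k + D.q = 1 ∧ l = D.l₀ then D.A else 0) := by
    have := D.A_pos
    split_ifs <;> positivity
  have h2 : 0 ≤ (if D.p ≤ l then D.B * (((k + D.q : ℕ) : ℝ) ^ D.h * D.g (l - D.p)
      * D.sol (k + D.q) (l - D.p)) else 0) := by
    have := D.B_pos
    have := D.sol_nonneg (k + D.q) (l - D.p)
    have := D.g_nonneg (l - D.p)
    split_ifs <;> positivity
  linarith

theorem A_le_sym_mul_sol : D.A ≤ D.sym 1 D.l₀ * D.sol 1 D.l₀ := by
  rw [D.sym_mul_sol le_rfl, if_pos ⟨rfl, rfl⟩]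
  have h2 : 0 ≤ (if D.p ≤ D.l₀ then D.B * (((1 : ℕ) : ℝ) ^ D.h * D.g (D.l₀ - D.p)
      * D.sol 1 (D.l₀ - D.p)) else 0) := by
    have := D.B_pos
    have := D.sol_nonneg 1 (D.l₀ - D.p)
    have := D.g_nonneg (D.l₀ - D.p)
    split_ifs <;> positivity
  have h3 : 0 ≤ (if D.q ≤ 1 ∧ D.μ ≤ D.l₀ then D.C * (((1 - D.q : ℕ) : ℝ) ^ D.j
      * ((D.l₀ - D.μ + D.α).descFactorial D.α : ℝ)
      * D.sol (1 - D.q) (D.l₀ - D.μ + D.α)) else 0) := by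
    have := D.C_pos
    have := D.sol_nonneg (1 - D.q) (D.l₀ - D.μ + D.α)
    split_ifs <;> positivity
  linarith

/-- The formal power series with coefficients `D.sol`. -/
def series : Series := fun n => (D.sol (n 0) (n 1) : ℂ)

theorem cf_series (k l : ℕ) : cf D.series k l = D.sol k l := by
  change (D.sol (expo k l 0) (expo k l 1) : ℂ) = _
  simp [expo]

theorem isFormalSolution_series {rhs : Series → Series}
    (hrhs : ∀ u k l, cf (rhs u) k l = D.rhsCoeff (cf u) k l) :
    IsFormalSolution D.m D.c rhs D.series := by
  refine ⟨fun l => by rw [cf_series, sol_zero, Complex.ofReal_zero], series_ext fun k l => ?_⟩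
  rw [cf_opL, hrhs, rhsCoeff]
  simp only [cf_series]
  rcases Nat.eq_zero_or_pos k with rfl | hk
  · have := D.q_pos
    simp [sol_zero]
  · have := congrArg (Complex.ofReal) (D.sym_mul_sol hk l)
    push_cast [apply_ite Complex.ofReal] at this
    exact this

/-- The initial condition settles k = 0; for k ≥ 1 the symbol does not vanish and can be cancelled
from the recurrence. -/
theorem eq_series {rhs : Series → Series}
    (hrhs : ∀ u k l, cf (rhs u) k l = D.rhsCoeff (cf u) k l) {v : Series}
    (hv : IsFormalSolution D.m D.c rhs v) : v = D.series := by
  have hu := D.isFormalSolution_series hrhs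
  refine series_ext fun k l => ?_
  refine D.recurrence_induction (P := fun k l => cf v k l = cf D.series k l)
    (fun l => by rw [hv.1, hu.1]) (fun k l hk hB hC => ?_) k l
  have hne : (D.sym k l : ℂ) ≠ 0 := by exact_mod_cast (D.sym_pos hk l).ne'
  refine mul_left_cancel₀ hne ?_
  rw [← cf_opL, ← cf_opL, hv.2, hu.2, hrhs, hrhs, rhsCoeff, rhsCoeff]
  congr 1
  · congr 1
    split_ifs with h1
    · rw [hB h1]
    · rfl
  · split_ifs with h1
    · rw [hC h1.1 h1.2]
    · rfl

/-! ### The Newton polygon: position of (h, β) and a supporting line. -/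

theorem h_lt : D.h < D.m := (mem_Im.1 D.hβ_mem).1

theorem isLeast_d : IsLeast {y : ℝ | ((D.h : ℝ), (D.β : ℝ) - y) ∈ newtonPolygon D.m D.c} D.d :=
  isLeast_height _ _ _ _ D.h_lt.le

theorem quadrant_subset {v : ℕ × ℕ} (hv : v ∈ Lam0 D.m D.c) :
    {z : ℝ × ℝ | z.1 ≤ (v.1 : ℝ) ∧ z.2 ≤ (v.2 : ℝ)} ⊆ newtonPolygon D.m D.c :=
  (Set.subset_biUnion_of_mem (u := fun v : ℕ × ℕ =>
    {z : ℝ × ℝ | z.1 ≤ (v.1 : ℝ) ∧ z.2 ≤ (v.2 : ℝ)}) hv).trans (subset_convexHull ℝ _)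

/-- A linear function with non-negative coefficients that is at most `M` on `Λ₀` is at most `M` on
the Newton polygon. -/
theorem linear_le_of_mem {X Y M : ℝ} (hX : 0 ≤ X) (hY : 0 ≤ Y)
    (hM : ∀ v ∈ Lam0 D.m D.c, (v.1 : ℝ) * X + v.2 * Y ≤ M) {z : ℝ × ℝ}
    (hz : z ∈ newtonPolygon D.m D.c) : z.1 * X + z.2 * Y ≤ M := by
  have hconv : Convex ℝ {z : ℝ × ℝ | z.1 * X + z.2 * Y ≤ M} :=
    convex_halfSpace_le (f := fun z : ℝ × ℝ => z.1 * X + z.2 * Y)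
      ⟨fun a b => by simp; ring, fun a b => by simp; ring⟩ M
  refine convexHull_min ?_ hconv hz
  intro z hz
  simp only [Set.mem_iUnion] at hz
  obtain ⟨v, hv, h1, h2⟩ := hz
  have := hM v hv
  have h3 := mul_le_mul_of_nonneg_right h1 hX
  have h4 := mul_le_mul_of_nonneg_right h2 hY
  simp only [Set.mem_ofPred_eq]
  linarith

/-- The Newton polygon is stable under downward translations. -/
theorem mem_of_le {x y y' : ℝ} (hy : y' ≤ y) (hz : (x, y) ∈ newtonPolygon D.m D.c) :
    (x, y') ∈ newtonPolygon D.m D.c := by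
  have hconv : Convex ℝ ((fun z : ℝ × ℝ => z + (0, y' - y)) ⁻¹' newtonPolygon D.m D.c) :=
    (convex_convexHull ℝ _).translate_preimage_left (0, y' - y)
  have := convexHull_min (?_ : (⋃ v ∈ Lam0 D.m D.c,
    {z : ℝ × ℝ | z.1 ≤ (v.1 : ℝ) ∧ z.2 ≤ (v.2 : ℝ)}) ⊆ _) hconv hz
  · simpa using this
  · intro z hz
    simp only [Set.mem_iUnion] at hz
    obtain ⟨v, hv, h1, h2⟩ := hz
    refine D.quadrant_subset hv ⟨?_, ?_⟩
    · simpa using h1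
    · simp only [Prod.snd_add]
      linarith

theorem d_pos : 0 < D.d := by
  by_contra hd
  refine D.not_mem (D.mem_of_le (y := (D.β : ℝ) - D.d) ?_ D.isLeast_d.1)
  linarith [not_lt.1 hd]

/-- The Newton polygon has a supporting line of slope `-κ`, `0 ≤ κ < 1`, at the boundary point
with abscissa `h`. -/
theorem exists_support : ∃ κ : ℝ, 0 ≤ κ ∧ κ < 1 ∧
    ∀ v ∈ Lam0 D.m D.c, κ * v.1 + v.2 ≤ κ * D.h + D.β - D.d := by
  set N := newtonPolygon D.m D.c with hN
  -- An interior point could be moved slightly upwards inside the polygon, contradicting the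
  -- minimality of d.
  have hnot : ((D.h : ℝ), (D.β : ℝ) - D.d) ∉ interior N := by
    intro hmem
    have hcont : Continuous fun y : ℝ => ((D.h : ℝ), (D.β : ℝ) - y) := by fun_prop
    have hev : ∀ᶠ y in 𝓝 D.d, ((D.h : ℝ), (D.β : ℝ) - y) ∈ interior N :=
      hcont.continuousAt.eventually (isOpen_interior.mem_nhds hmem)
    obtain ⟨y, hy, hyd⟩ := ((hev.filter_mono nhdsWithin_le_nhds).and
      (self_mem_nhdsWithin (a := D.d) (s := Set.Iio D.d))).exists
    have hy' : ((D.h : ℝ), (D.β : ℝ) - y) ∈ N := interior_subset hy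
    exact absurd (D.isLeast_d.2 hy') (not_le.2 hyd)
  obtain ⟨f, hf⟩ := geometric_hahn_banach_open_point
    ((convex_convexHull ℝ _).interior : Convex ℝ (interior N)) isOpen_interior hnot
  set f1 := f (1, 0) with hf1
  set f2 := f (0, 1) with hf2
  have hfe : ∀ x y : ℝ, f (x, y) = x * f1 + y * f2 := by
    intro x y
    have : ((x, y) : ℝ × ℝ) = x • ((1 : ℝ), (0 : ℝ)) + y • ((0 : ℝ), (1 : ℝ)) := by simp
    rw [this, map_add, map_smul, map_smul, smul_eq_mul, smul_eq_mul]
  have hint : ∀ v ∈ Lam0 D.m D.c, ∀ x y : ℝ, x < v.1 → y < v.2 →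
      x * f1 + y * f2 < D.h * f1 + ((D.β : ℝ) - D.d) * f2 := by
    intro v hv x y hx hy
    rw [← hfe, ← hfe]
    refine hf _ (mem_interior.2 ⟨Set.Iio (v.1 : ℝ) ×ˢ Set.Iio (v.2 : ℝ), ?_,
      isOpen_Iio.prod isOpen_Iio, ⟨hx, hy⟩⟩)
    rintro ⟨a, b⟩ ⟨ha, hb⟩
    exact D.quadrant_subset hv ⟨le_of_lt ha, le_of_lt hb⟩
  set Z := D.h * f1 + ((D.β : ℝ) - D.d) * f2 with hZ
  have hm0 : (D.m, 0) ∈ Lam0 D.m D.c := Or.inl rfl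
  have hle : ∀ v ∈ Lam0 D.m D.c, v.1 * f1 + v.2 * f2 ≤ Z := by
    intro v hv
    have hlim : Filter.Tendsto (fun ε : ℝ => ((v.1 : ℝ) - ε) * f1 + ((v.2 : ℝ) - ε) * f2)
        (𝓝[>] 0) (𝓝 (v.1 * f1 + v.2 * f2)) := by
      have : Continuous fun ε : ℝ => ((v.1 : ℝ) - ε) * f1 + ((v.2 : ℝ) - ε) * f2 := by fun_prop
      have h := this.tendsto 0
      simp only [sub_zero] at h
      exact h.mono_left nhdsWithin_le_nhds
    refine le_of_tendsto hlim ?_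
    filter_upwards [self_mem_nhdsWithin] with ε hε
    have hε' : (0 : ℝ) < ε := hε
    exact (hint v hv _ _ (by linarith) (by linarith)).le
  have hf1n : 0 ≤ f1 := by
    by_contra hneg
    push Not at hneg
    -- If f1 were negative, the functional would be unbounded on the quadrant below (m, 0). The
    -- point is chosen far enough to the left that its value is at least Z.
    have h1 := hint _ hm0 ((D.m : ℝ) - 1 - (|Z - (D.m - 1) * f1 + f2|) / (-f1)) (-1)
      (by have : 0 ≤ |Z - (D.m - 1) * f1 + f2| / (-f1) := div_nonneg (abs_nonneg _) (by linarith)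
          linarith) (by norm_num)
    have h2 : |Z - (D.m - 1) * f1 + f2| / (-f1) * f1 = -|Z - (D.m - 1) * f1 + f2| := by
      rw [div_neg, neg_mul, div_mul_cancel₀ _ hneg.ne]
    have h3 := le_abs_self (Z - (D.m - 1) * f1 + f2)
    nlinarith
  have hf2n : 0 ≤ f2 := by
    by_contra hneg
    push Not at hneg
    have h1 := hint _ hm0 ((D.m : ℝ) - 1) (-1 - (|Z - (D.m - 1) * f1 + f2|) / (-f2))
      (by simp) (by
        have : 0 ≤ |Z - (D.m - 1) * f1 + f2| / (-f2) := div_nonneg (abs_nonneg _) (by linarith)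
        simp only [Nat.cast_zero]
        linarith)
    have h2 : |Z - (D.m - 1) * f1 + f2| / (-f2) * f2 = -|Z - (D.m - 1) * f1 + f2| := by
      rw [div_neg, neg_mul, div_mul_cancel₀ _ hneg.ne]
    have h3 := le_abs_self (Z - (D.m - 1) * f1 + f2)
    nlinarith
  have hhm : (D.h : ℝ) + 1 ≤ D.m := by exact_mod_cast D.h_lt
  have hf2p : 0 < f2 := by
    rcases hf2n.lt_or_eq with h | h
    · exact h
    -- With f2 = 0, the vertex (m, 0) and h < m force f1 = 0, which the strict inequality on the
    -- open quadrant excludes.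
    · have h1 := hle _ hm0
      have h2 := hint _ hm0 ((D.m : ℝ) - 1) (-1) (by simp) (by simp)
      rw [hZ, ← h] at h1 h2
      simp only [mul_zero, add_zero] at h1 h2
      nlinarith
  have hκ : ∀ v ∈ Lam0 D.m D.c, f1 / f2 * v.1 + v.2 ≤ f1 / f2 * D.h + D.β - D.d := by
    intro v hv
    have h1 := hle v hv
    rw [hZ] at h1
    have h2 : (f1 / f2 * v.1 + v.2) * f2 ≤ (f1 / f2 * D.h + D.β - D.d) * f2 := by
      have h3 : f1 / f2 * f2 = f1 := div_mul_cancel₀ _ hf2p.ne'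
      nlinarith
    exact le_of_mul_le_mul_right h2 hf2p
  refine ⟨f1 / f2, by positivity, ?_, hκ⟩
  -- The vertex (m, 0) gives κ(m-h) ≤ β-d, and β-d < m-h since d > 0 and h+β ≤ m.
  have h1 := hκ _ hm0
  have h2 : (D.h : ℝ) + D.β ≤ D.m := by exact_mod_cast (mem_Im.1 D.hβ_mem).2
  have h3 := D.d_pos
  simp only [Nat.cast_zero, add_zero] at h1
  by_contra hge
  push Not at hge
  nlinarith

end Model

/-! ### Factorial estimates for the upper bound. -/

/-- Each of the a factors of the falling factorial is at least l+1-a, and l ≤ a(l+1-a) once 1 ≤ a ≤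
l. -/
theorem pow_le_mul_descFactorial {a l : ℕ} (h : a ≤ l) : l ^ a ≤ a ^ a * l.descFactorial a := by
  rcases Nat.eq_zero_or_pos a with rfl | ha
  · simp
  · obtain ⟨t, rfl⟩ := Nat.exists_eq_add_of_le h
    have h1 : a + t ≤ a * (a + t + 1 - a) := by
      rw [show a + t + 1 - a = t + 1 by omega]
      nlinarith
    calc (a + t) ^ a ≤ (a * (a + t + 1 - a)) ^ a := Nat.pow_le_pow_left h1 a
      _ = a ^ a * (a + t + 1 - a) ^ a := mul_pow _ _ _
      _ ≤ _ := Nat.mul_le_mul_left _ (Nat.pow_sub_le_descFactorial _ _)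

/-- Among the factors l+1, …, l+x+n, the block of length x starting at l+δ+1 is the second factor on
the left; the n remaining ones are each at least l+1. The condition δ ≤ n makes the block fit. This
is how one t-step is absorbed. -/
theorem pow_mul_ascFactorial_le {l δ n x : ℕ} (h : δ ≤ n) :
    (l + 1) ^ n * (l + δ + 1).ascFactorial x ≤ (l + 1).ascFactorial (x + n) := by
  have e : (l + 1).ascFactorial (x + n) = (l + 1).ascFactorial δ
      * (l + δ + 1).ascFactorial x * (l + δ + 1 + x).ascFactorial (n - δ) := by
    rw [show l + δ + 1 = l + 1 + δ by ring, Nat.ascFactorial_mul_ascFactorial,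
      show l + 1 + δ + x = l + 1 + (δ + x) by ring, Nat.ascFactorial_mul_ascFactorial]
    congr 1
    omega
  have h1 : (l + 1) ^ δ ≤ (l + 1).ascFactorial δ := Nat.pow_succ_le_ascFactorial _ _
  have h2 : (l + 1) ^ (n - δ) ≤ (l + δ + 1 + x).ascFactorial (n - δ) :=
    (Nat.pow_le_pow_left (by omega) _).trans (Nat.pow_succ_le_ascFactorial _ _)
  calc (l + 1) ^ n * (l + δ + 1).ascFactorial x
      = (l + 1) ^ δ * (l + δ + 1).ascFactorial x * (l + 1) ^ (n - δ) := by
        rw [mul_right_comm, ← pow_add, Nat.add_sub_cancel' h]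
    _ ≤ _ := by
        rw [e]
        gcongr

theorem exists_factorial_mul_le (a : ℕ) : ∃ c : ℕ, 1 ≤ c ∧ ∀ k : ℕ, (a * k)! ≤ c ^ k * k ! ^ a := by
  induction a with
  | zero => exact ⟨1, le_rfl, fun k => by simp⟩
  | succ a ih =>
    obtain ⟨c, hc, h⟩ := ih
    refine ⟨c * 2 ^ (a + 1), one_le_mul hc Nat.one_le_two_pow, fun k => ?_⟩
    have h1 : ((a + 1) * k)! = ((a * k) + k).choose k * (a * k)! * k ! := by
      rw [Nat.add_choose_mul_factorial_mul_factorial]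
      congr 1
      ring
    have h2 : ((a * k) + k).choose k ≤ (2 ^ (a + 1)) ^ k := by
      rw [← pow_mul, show (a + 1) * k = a * k + k by ring]
      exact Nat.choose_le_two_pow _ _
    calc ((a + 1) * k)! ≤ (2 ^ (a + 1)) ^ k * (c ^ k * k ! ^ a) * k ! := by
          rw [h1]
          gcongr
          exact h k
      _ = _ := by rw [mul_pow, pow_succ]; ring

/-- The product equals (ak)! times a binomial coefficient; the latter is at most a power of 2, and
(ak)! differs from k!^a by a geometric factor. -/
theorem exists_ascFactorial_le (a : ℕ) :
    ∃ c : ℝ, 1 ≤ c ∧ ∀ k l : ℕ, ((l + 1).ascFactorial (a * k) : ℝ) ≤ c ^ (k + l) * (k ! : ℝ) ^ a := by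
  obtain ⟨c, hc, h⟩ := exists_factorial_mul_le a
  have hnat : ∀ k l : ℕ,
      (l + 1).ascFactorial (a * k) ≤ (c * 2 ^ (a + 1)) ^ (k + l) * k ! ^ a := by
    intro k l
    rw [Nat.ascFactorial_eq_factorial_mul_choose]
    have h1 : (l + a * k).choose (a * k) ≤ (2 ^ (a + 1)) ^ (k + l) := by
      refine (Nat.choose_le_two_pow _ _).trans ?_
      rw [← pow_mul]
      refine Nat.pow_le_pow_right (by norm_num) ?_
      nlinarith [Nat.zero_le (a * l)]
    calc (a * k)! * (l + a * k).choose (a * k)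
        ≤ (c ^ (k + l) * k ! ^ a) * (2 ^ (a + 1)) ^ (k + l) := by
          refine Nat.mul_le_mul ((h k).trans ?_) h1
          exact Nat.mul_le_mul_right _ (Nat.pow_le_pow_right hc (by omega))
      _ = _ := by rw [mul_pow]; ring
  refine ⟨((c * 2 ^ (a + 1) : ℕ) : ℝ), ?_, fun k l => by exact_mod_cast hnat k l⟩
  exact_mod_cast one_le_mul hc Nat.one_le_two_pow

/-! ### Upper bounds for the coefficients. -/

namespace Model

variable (D : Model)

/-- After taking logarithms, a monomial at exponent (x, y) becomes the linear form x log k + y log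
l, with non-negative coefficients. Its bound on Λ₀ therefore extends to the whole polygon, in
particular to (h, β-d). -/
theorem pow_mul_pow_le_sum {k l : ℕ} (hk : 1 ≤ k) (hl : 1 ≤ l) :
    (k : ℝ) ^ D.h * (l : ℝ) ^ D.β ≤ (l : ℝ) ^ D.d * ((k : ℝ) ^ D.m
      + ∑ v ∈ (Im D.m).filter (fun v => D.c v ≠ 0), (k : ℝ) ^ v.1 * (l : ℝ) ^ v.2) := by
  have hk0 : (0 : ℝ) < k := by exact_mod_cast hk
  have hl0 : (0 : ℝ) < l := by exact_mod_cast hl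
  set T := ∑ v ∈ (Im D.m).filter (fun v => D.c v ≠ 0), (k : ℝ) ^ v.1 * (l : ℝ) ^ v.2 with hT
  have hT0 : 0 ≤ T := Finset.sum_nonneg fun v _ => by positivity
  have hkm : (0 : ℝ) < (k : ℝ) ^ D.m := by positivity
  have hlog : ∀ a b : ℕ, Real.log ((k : ℝ) ^ a * (l : ℝ) ^ b)
      = a * Real.log k + b * Real.log l := by
    intro a b
    rw [Real.log_mul (by positivity) (by positivity), Real.log_pow, Real.log_pow]
  have hS : ∀ v ∈ Lam0 D.m D.c, (v.1 : ℝ) * Real.log k + v.2 * Real.log l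
      ≤ Real.log ((k : ℝ) ^ D.m + T) := by
    intro v hv
    rw [← hlog]
    refine Real.log_le_log (by positivity) ?_
    rcases hv with rfl | ⟨hv, hcv⟩
    · simpa using hT0
    · have := Finset.single_le_sum (s := (Im D.m).filter (fun v => D.c v ≠ 0))
        (f := fun v : ℕ × ℕ => (k : ℝ) ^ v.1 * (l : ℝ) ^ v.2)
        (fun v _ => by positivity) (Finset.mem_filter.2 ⟨hv, hcv⟩)
      linarith
  have h1 := D.linear_le_of_mem (Real.log_nonneg (by exact_mod_cast hk))
    (Real.log_nonneg (by exact_mod_cast hl)) hS D.isLeast_d.1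
  have hpos : (0 : ℝ) < (l : ℝ) ^ D.d * ((k : ℝ) ^ D.m + T) := by positivity
  rw [← Real.log_le_log_iff (by positivity) hpos, hlog,
    Real.log_mul (by positivity) (by positivity), Real.log_rpow hl0]
  simp only at h1
  linarith

/-- The price of an x-step. The symbol contains falling factorials, which are comparable to powers
of l only for l ≥ m; for smaller l the factor l^β is bounded and k^m alone suffices. -/
theorem exists_coeff_x_le : ∃ K > 0, ∀ k l : ℕ, 1 ≤ k → 1 ≤ l →
    (k : ℝ) ^ D.h * (l : ℝ) ^ D.β ≤ K * (l : ℝ) ^ D.d * D.sym k l := by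
  have hm := D.m_pos
  have hd := D.d_pos
  set F := (Im D.m).filter (fun v => D.c v ≠ 0) with hF
  have hneg : ∀ v ∈ F, 0 < -D.c v := by
    intro v hv
    obtain ⟨h1, h2⟩ := Finset.mem_filter.1 hv
    exact neg_pos.2 (lt_of_le_of_ne (D.c_nonpos v h1) h2)
  set K₂ : ℝ := 1 + ∑ v ∈ F, (D.m : ℝ) ^ D.m * (-D.c v)⁻¹ with hK₂
  have hsum0 : 0 ≤ ∑ v ∈ F, (D.m : ℝ) ^ D.m * (-D.c v)⁻¹ :=
    Finset.sum_nonneg fun v hv => mul_nonneg (by positivity) (inv_nonneg.2 (hneg v hv).le)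
  refine ⟨(D.m : ℝ) ^ D.β + K₂, by positivity, fun k l hk hl => ?_⟩
  have hsym := D.sym_pos hk l
  have hk1 : (1 : ℝ) ≤ k := by exact_mod_cast hk
  have hl1 : (1 : ℝ) ≤ l := by exact_mod_cast hl
  have hld : (1 : ℝ) ≤ (l : ℝ) ^ D.d := Real.one_le_rpow hl1 hd.le
  rcases lt_or_ge l D.m with hlm | hlm
  · have h1 : (k : ℝ) ^ D.h ≤ D.sym k l :=
      (pow_le_pow_right₀ hk1 D.h_lt.le).trans (D.pow_le_sym k l)
    have h2 : (l : ℝ) ^ D.β ≤ (D.m : ℝ) ^ D.β := by gcongr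
    calc (k : ℝ) ^ D.h * (l : ℝ) ^ D.β ≤ D.sym k l * (D.m : ℝ) ^ D.β := by gcongr
      _ = (D.m : ℝ) ^ D.β * 1 * D.sym k l := by ring
      _ ≤ ((D.m : ℝ) ^ D.β + K₂) * (l : ℝ) ^ D.d * D.sym k l := by
        gcongr
        linarith
  · have hterm : ∀ v ∈ F, (k : ℝ) ^ v.1 * (l : ℝ) ^ v.2
        ≤ (D.m : ℝ) ^ D.m * (-D.c v)⁻¹ * D.sym k l := by
      intro v hv
      obtain ⟨hv1, hv2⟩ := Finset.mem_filter.1 hv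
      have hvm : v.2 ≤ D.m := by have := (mem_Im.1 (show (v.1, v.2) ∈ Im D.m from hv1)).2; omega
      have h1 : l ^ v.2 ≤ D.m ^ D.m * l.descFactorial v.2 := by
        refine (pow_le_mul_descFactorial (hvm.trans hlm)).trans (Nat.mul_le_mul_right _ ?_)
        exact (Nat.pow_le_pow_left hvm _).trans (Nat.pow_le_pow_right hm hvm)
      have h1' : (l : ℝ) ^ v.2 ≤ (D.m : ℝ) ^ D.m * (l.descFactorial v.2 : ℝ) := by
        exact_mod_cast h1
      have h2 := D.term_le_sym hv1 k l
      have hc := hneg v hv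
      calc (k : ℝ) ^ v.1 * (l : ℝ) ^ v.2
          ≤ (k : ℝ) ^ v.1 * ((D.m : ℝ) ^ D.m * (l.descFactorial v.2 : ℝ)) := by gcongr
        _ = (D.m : ℝ) ^ D.m * (-D.c v)⁻¹
            * (-D.c v * ((k : ℝ) ^ v.1 * (l.descFactorial v.2 : ℝ))) := by
          field_simp
        _ ≤ _ := by gcongr
    have hS : (k : ℝ) ^ D.m + ∑ v ∈ F, (k : ℝ) ^ v.1 * (l : ℝ) ^ v.2 ≤ K₂ * D.sym k l := by
      rw [hK₂, add_mul, one_mul, Finset.sum_mul]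
      exact add_le_add (D.pow_le_sym k l) (Finset.sum_le_sum hterm)
    calc (k : ℝ) ^ D.h * (l : ℝ) ^ D.β
        ≤ (l : ℝ) ^ D.d * (K₂ * D.sym k l) := (D.pow_mul_pow_le_sum hk hl).trans (by gcongr)
      _ = K₂ * (l : ℝ) ^ D.d * D.sym k l := by ring
      _ ≤ _ := by
        gcongr
        have : (0 : ℝ) ≤ (D.m : ℝ) ^ D.β := by positivity
        linarith

/-- The exponent `d / p`. -/
def e : ℝ := D.d / D.p

/-- The exponent `α + (d / p) (α - μ)`. -/
def E : ℝ := D.α + D.e * D.δ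

theorem e_pos : 0 < D.e := div_pos D.d_pos (by exact_mod_cast D.p_pos)

theorem α_pos : 1 ≤ D.α := by have := D.μ_lt_α; omega

theorem E_pos : 0 < D.E := by
  have h1 : (0 : ℝ) < D.α := by exact_mod_cast D.α_pos
  have := D.e_pos
  unfold E
  positivity

/-- The majorant of the coefficients of the solution. -/
def weight (k l : ℕ) : ℝ :=
  (k ! : ℝ) ^ (-(((D.m : ℝ) - D.j) / D.q))
    * (((l + 1).ascFactorial (D.α * k) : ℕ) : ℝ) ^ (D.E / (D.α * D.q)) * (l ! : ℝ) ^ D.e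

theorem weight_pos (k l : ℕ) : 0 < D.weight k l := by
  have h1 : (0 : ℝ) < (k ! : ℝ) := by exact_mod_cast Nat.factorial_pos k
  have h2 : (0 : ℝ) < (l ! : ℝ) := by exact_mod_cast Nat.factorial_pos l
  have h3 : (0 : ℝ) < (((l + 1).ascFactorial (D.α * k) : ℕ) : ℝ) := by
    exact_mod_cast Nat.ascFactorial_pos _ _
  unfold weight
  positivity

theorem E_div_nonneg : 0 ≤ D.E / (D.α * D.q) := by
  have := D.E_pos
  positivity

/-- The factor l^d lost in an x-step is (l^p)^e, and l^p (l-p)! is at most a constant times l!. The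
ascending factorial only grows with l. -/
theorem exists_weight_shift_x : ∃ K > 0, ∀ k l : ℕ, 1 ≤ k → D.p ≤ l →
    (k : ℝ) ^ D.h * D.g (l - D.p) * D.weight k (l - D.p) ≤ K * D.sym k l * D.weight k l := by
  obtain ⟨K, hK, hx⟩ := D.exists_coeff_x_le
  have hp := D.p_pos
  have he := D.e_pos
  have hpR : (0 : ℝ) < D.p := by exact_mod_cast hp
  refine ⟨K * ((D.p : ℝ) ^ D.p) ^ D.e, by positivity, fun k l hk hl => ?_⟩
  have hsym := D.sym_pos hk l
  have hk1 : (0 : ℝ) < k := by exact_mod_cast hk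
  have hl1 : (0 : ℝ) < l := by exact_mod_cast hp.trans hl
  have hg : D.g (l - D.p) ≤ (l : ℝ) ^ D.β := by
    refine (D.g_le_pow _).trans ?_
    gcongr
    exact_mod_cast Nat.sub_le _ _
  have hfac : (l : ℝ) ^ D.p * ((l - D.p)! : ℝ) ≤ (D.p : ℝ) ^ D.p * (l ! : ℝ) := by
    have h1 := pow_le_mul_descFactorial hl
    have h2 := Nat.factorial_mul_descFactorial hl
    have h3 : l ^ D.p * (l - D.p)! ≤ D.p ^ D.p * l ! := by
      rw [← h2]
      calc l ^ D.p * (l - D.p)! ≤ D.p ^ D.p * l.descFactorial D.p * (l - D.p)! := by gcongr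
        _ = _ := by ring
    exact_mod_cast h3
  have hfac' : (l : ℝ) ^ D.d * ((l - D.p)! : ℝ) ^ D.e
      ≤ ((D.p : ℝ) ^ D.p) ^ D.e * (l ! : ℝ) ^ D.e := by
    have h1 : (l : ℝ) ^ D.d = ((l : ℝ) ^ D.p) ^ D.e := by
      rw [← Real.rpow_natCast, ← Real.rpow_mul hl1.le, e, mul_div_cancel₀ _ hpR.ne']
    rw [h1, ← Real.mul_rpow (by positivity) (by positivity),
      ← Real.mul_rpow (by positivity) (by positivity)]
    exact Real.rpow_le_rpow (by positivity) hfac he.le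
  have hasc : (((l - D.p + 1).ascFactorial (D.α * k) : ℕ) : ℝ) ^ (D.E / (D.α * D.q))
      ≤ (((l + 1).ascFactorial (D.α * k) : ℕ) : ℝ) ^ (D.E / (D.α * D.q)) := by
    refine Real.rpow_le_rpow (by positivity) ?_ D.E_div_nonneg
    exact_mod_cast Nat.ascFactorial_le _ (by omega)
  set V := (k ! : ℝ) ^ (-(((D.m : ℝ) - D.j) / D.q)) with hV
  have hV0 : 0 ≤ V := by positivity
  set a₁ := (((l - D.p + 1).ascFactorial (D.α * k) : ℕ) : ℝ) ^ (D.E / (D.α * D.q)) with ha₁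
  set a₂ := (((l + 1).ascFactorial (D.α * k) : ℕ) : ℝ) ^ (D.E / (D.α * D.q)) with ha₂
  have ha₁0 : 0 ≤ a₁ := by positivity
  calc (k : ℝ) ^ D.h * D.g (l - D.p) * D.weight k (l - D.p)
      ≤ (k : ℝ) ^ D.h * (l : ℝ) ^ D.β * D.weight k (l - D.p) := by
        have := (D.weight_pos k (l - D.p)).le
        gcongr
    _ ≤ K * (l : ℝ) ^ D.d * D.sym k l * D.weight k (l - D.p) := by
        have := (D.weight_pos k (l - D.p)).le
        have := hx k l hk (hp.trans hl)
        gcongr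
    _ = K * D.sym k l * (V * a₁ * ((l : ℝ) ^ D.d * ((l - D.p)! : ℝ) ^ D.e)) := by
        rw [weight]; ring
    _ ≤ K * D.sym k l * (V * a₂ * (((D.p : ℝ) ^ D.p) ^ D.e * (l ! : ℝ) ^ D.e)) := by
        gcongr
    _ = _ := by rw [weight]; ring

/-- In a t-step the negative power of k! turns k^j into (k+q)^m, which the symbol dominates. The
powers of l, of total exponent E, are absorbed by the αq additional factors of the ascending
factorial, each raised to E/(αq). -/
theorem exists_weight_shift_t : ∃ K > 0, ∀ k l : ℕ, 1 ≤ k →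
    (k : ℝ) ^ D.j * ((l + D.δ).descFactorial D.α : ℝ) * D.weight k (l + D.δ)
      ≤ K * D.sym (k + D.q) l * D.weight (k + D.q) l := by
  have he := D.e_pos
  have hE := D.E_pos
  have hq := D.q_pos
  have hα := D.α_pos
  have hqR : (0 : ℝ) < D.q := by exact_mod_cast hq
  have hαR : (0 : ℝ) < D.α := by exact_mod_cast hα
  have hjm : D.j < D.m := (mem_Im.1 D.jα_mem).1
  have hjmR : (0 : ℝ) < (D.m : ℝ) - D.j := by
    have : (D.j : ℝ) < D.m := by exact_mod_cast hjm
    linarith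
  refine ⟨((D.α : ℝ) + 1) ^ D.E, by positivity, fun k l hk => ?_⟩
  have hk0 : (0 : ℝ) < k := by exact_mod_cast hk
  set b' := ((D.m : ℝ) - D.j) / D.q with hb'
  have hb'0 : 0 < b' := by positivity
  have hf0 : ∀ n : ℕ, (0 : ℝ) < (n ! : ℝ) := fun n => by exact_mod_cast Nat.factorial_pos n
  have hfk : ((k + D.q)! : ℝ) ^ b' ≤ ((k + D.q : ℕ) : ℝ) ^ (D.m - D.j) * (k ! : ℝ) ^ b' := by
    have h1 : (k + D.q)! ≤ (k + D.q) ^ D.q * k ! := by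
      have h2 := Nat.factorial_mul_descFactorial (Nat.le_add_left D.q k)
      rw [Nat.add_sub_cancel] at h2
      rw [← h2, mul_comm]
      exact Nat.mul_le_mul_right _ (Nat.descFactorial_le_pow _ _)
    have h1' : ((k + D.q)! : ℝ) ≤ ((k + D.q : ℕ) : ℝ) ^ D.q * (k ! : ℝ) := by exact_mod_cast h1
    refine (Real.rpow_le_rpow (hf0 _).le h1' hb'0.le).trans ?_
    rw [Real.mul_rpow (by positivity) (hf0 _).le, ← Real.rpow_natCast, ← Real.rpow_mul (by positivity),
      hb', mul_div_cancel₀ _ hqR.ne', ← Nat.cast_sub hjm.le, Real.rpow_natCast]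
  have hfk' : (k : ℝ) ^ D.j * (k ! : ℝ) ^ (-b')
      ≤ ((k + D.q : ℕ) : ℝ) ^ D.m * ((k + D.q)! : ℝ) ^ (-b') := by
    have h1 : (k ! : ℝ) ^ (-b') ≤ ((k + D.q : ℕ) : ℝ) ^ (D.m - D.j) * ((k + D.q)! : ℝ) ^ (-b') := by
      rw [Real.rpow_neg (hf0 _).le, Real.rpow_neg (hf0 _).le, ← div_eq_mul_inv, inv_eq_one_div,
        div_le_div_iff₀ (Real.rpow_pos_of_pos (hf0 _) _) (Real.rpow_pos_of_pos (hf0 _) _), one_mul]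
      exact hfk
    have h2 : (k : ℝ) ^ D.j ≤ ((k + D.q : ℕ) : ℝ) ^ D.j := by
      gcongr
      omega
    calc (k : ℝ) ^ D.j * (k ! : ℝ) ^ (-b')
        ≤ ((k + D.q : ℕ) : ℝ) ^ D.j
          * (((k + D.q : ℕ) : ℝ) ^ (D.m - D.j) * ((k + D.q)! : ℝ) ^ (-b')) := by
          have := Real.rpow_pos_of_pos (hf0 k) (-b')
          gcongr
      _ = _ := by rw [← mul_assoc, ← pow_add, Nat.add_sub_cancel' hjm.le]
  have hα1 : (l : ℝ) + D.α ≤ ((D.α : ℝ) + 1) * (l + 1) := by nlinarith [Nat.cast_nonneg (α := ℝ) l]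
  have hδα : D.δ ≤ D.α := Nat.sub_le _ _
  have hdesc : ((l + D.δ).descFactorial D.α : ℝ) ≤ ((l : ℝ) + D.α) ^ (D.α : ℝ) := by
    have h1 : (l + D.δ).descFactorial D.α ≤ (l + D.α) ^ D.α :=
      (Nat.descFactorial_le_pow _ _).trans (Nat.pow_le_pow_left (by omega) _)
    rw [Real.rpow_natCast]
    exact_mod_cast h1
  have hfl : ((l + D.δ)! : ℝ) ^ D.e ≤ ((l : ℝ) + D.α) ^ (D.e * D.δ) * (l ! : ℝ) ^ D.e := by
    have h1 : (l + D.δ)! ≤ (l + D.α) ^ D.δ * l ! := by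
      have h2 := Nat.factorial_mul_descFactorial (Nat.le_add_left D.δ l)
      rw [Nat.add_sub_cancel] at h2
      rw [← h2, mul_comm]
      refine Nat.mul_le_mul_right _ ((Nat.descFactorial_le_pow _ _).trans ?_)
      exact Nat.pow_le_pow_left (by omega) _
    have h1' : ((l + D.δ)! : ℝ) ≤ ((l : ℝ) + D.α) ^ D.δ * (l ! : ℝ) := by exact_mod_cast h1
    refine (Real.rpow_le_rpow (hf0 _).le h1' he.le).trans ?_
    rw [Real.mul_rpow (by positivity) (hf0 _).le, ← Real.rpow_natCast,
      ← Real.rpow_mul (by positivity), mul_comm (D.δ : ℝ)]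
  have hasc : ((l : ℝ) + 1) ^ D.E
      * (((l + D.δ + 1).ascFactorial (D.α * k) : ℕ) : ℝ) ^ (D.E / (D.α * D.q))
      ≤ (((l + 1).ascFactorial (D.α * (k + D.q)) : ℕ) : ℝ) ^ (D.E / (D.α * D.q)) := by
    have h1 : (l + 1) ^ (D.α * D.q) * (l + D.δ + 1).ascFactorial (D.α * k)
        ≤ (l + 1).ascFactorial (D.α * (k + D.q)) := by
      rw [mul_add]
      exact pow_mul_ascFactorial_le (hδα.trans (Nat.le_mul_of_pos_right _ hq))
    have h1' : ((l : ℝ) + 1) ^ (D.α * D.q) * (((l + D.δ + 1).ascFactorial (D.α * k) : ℕ) : ℝ)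
        ≤ (((l + 1).ascFactorial (D.α * (k + D.q)) : ℕ) : ℝ) := by exact_mod_cast h1
    have h2 : ((l : ℝ) + 1) ^ D.E = (((l : ℝ) + 1) ^ (D.α * D.q)) ^ (D.E / (D.α * D.q)) := by
      rw [← Real.rpow_natCast, ← Real.rpow_mul (by positivity)]
      congr 1
      push_cast
      field_simp
    rw [h2, ← Real.mul_rpow (by positivity) (by positivity)]
    exact Real.rpow_le_rpow (by positivity) h1' D.E_div_nonneg
  set b := D.E / (D.α * D.q) with hb
  set a₁ := (((l + D.δ + 1).ascFactorial (D.α * k) : ℕ) : ℝ) ^ b with ha₁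
  set a₂ := (((l + 1).ascFactorial (D.α * (k + D.q)) : ℕ) : ℝ) ^ b with ha₂
  have ha₁0 : 0 ≤ a₁ := by positivity
  have ha₂0 : 0 ≤ a₂ := by positivity
  have hlE : ((l : ℝ) + D.α) ^ (D.α : ℝ) * ((l : ℝ) + D.α) ^ (D.e * D.δ)
      ≤ ((D.α : ℝ) + 1) ^ D.E * ((l : ℝ) + 1) ^ D.E := by
    rw [← Real.rpow_add (by positivity), ← Real.mul_rpow (by positivity) (by positivity)]
    exact Real.rpow_le_rpow (by positivity) hα1 hE.le
  set P := (k : ℝ) ^ D.j * (k ! : ℝ) ^ (-b') with hP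
  have hP0 : 0 ≤ P := by positivity
  set Q := ((k + D.q)! : ℝ) ^ (-b') with hQ
  have hQ0 : 0 ≤ Q := by positivity
  calc (k : ℝ) ^ D.j * ((l + D.δ).descFactorial D.α : ℝ) * D.weight k (l + D.δ)
      = P * ((l + D.δ).descFactorial D.α : ℝ) * a₁ * ((l + D.δ)! : ℝ) ^ D.e := by
        rw [weight]; ring
    _ ≤ P * ((l : ℝ) + D.α) ^ (D.α : ℝ) * a₁
        * (((l : ℝ) + D.α) ^ (D.e * D.δ) * (l ! : ℝ) ^ D.e) := by gcongr
    _ = P * (((l : ℝ) + D.α) ^ (D.α : ℝ) * ((l : ℝ) + D.α) ^ (D.e * D.δ)) * a₁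
        * (l ! : ℝ) ^ D.e := by ring
    _ ≤ P * (((D.α : ℝ) + 1) ^ D.E * ((l : ℝ) + 1) ^ D.E) * a₁ * (l ! : ℝ) ^ D.e := by gcongr
    _ = P * ((D.α : ℝ) + 1) ^ D.E * (((l : ℝ) + 1) ^ D.E * a₁) * (l ! : ℝ) ^ D.e := by ring
    _ ≤ (((k + D.q : ℕ) : ℝ) ^ D.m * Q) * ((D.α : ℝ) + 1) ^ D.E * a₂ * (l ! : ℝ) ^ D.e := by
        gcongr
    _ = ((D.α : ℝ) + 1) ^ D.E * ((k + D.q : ℕ) : ℝ) ^ D.m * (Q * a₂ * (l ! : ℝ) ^ D.e) := by ring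
    _ ≤ ((D.α : ℝ) + 1) ^ D.E * D.sym (k + D.q) l * (Q * a₂ * (l ! : ℝ) ^ D.e) := by
        have := D.pow_le_sym (k + D.q) l
        gcongr
    _ = _ := by rw [weight]

theorem exists_sol_le_weight : ∃ M R : ℝ, 0 < M ∧ 1 ≤ R ∧ ∀ k l : ℕ,
    D.sol k l ≤ M * R ^ (k + l) * D.weight k l := by
  obtain ⟨K₁, hK₁, h₁⟩ := D.exists_weight_shift_x
  obtain ⟨K₂, hK₂, h₂⟩ := D.exists_weight_shift_t
  have hA := D.A_pos
  have hB := D.B_pos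
  have hC := D.C_pos
  have hp := D.p_pos
  have hq := D.q_pos
  -- Each of the three terms of the recurrence receives one third of the bound: M pays for the
  -- source, S for an x-step, R for a t-step. The factor S^δ in R compensates for the t-step
  -- starting from l+δ.
  set S : ℝ := 1 + 3 * D.B * K₁ with hS
  have hS1 : 1 ≤ S := by rw [hS]; have : 0 < 3 * D.B * K₁ := by positivity
                         linarith
  set R : ℝ := 1 + 3 * D.C * K₂ * S ^ D.δ with hR
  have hR1 : 1 ≤ R := by rw [hR]; have : 0 < 3 * D.C * K₂ * S ^ D.δ := by positivity
                         linarith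
  set M : ℝ := 3 * D.A / (D.sym 1 D.l₀ * D.weight 1 D.l₀) with hM
  have hs0 := D.sym_pos le_rfl D.l₀
  have hw0 := D.weight_pos 1 D.l₀
  have hM0 : 0 < M := by positivity
  have key : ∀ k l : ℕ, D.sol k l ≤ M * (R ^ k * S ^ l) * D.weight k l := by
    refine D.recurrence_induction (fun l => ?_) (fun k l hk ihB ihC => ?_)
    · rw [sol_zero]
      have := D.weight_pos 0 l
      positivity
    have hsym := D.sym_pos hk l
    have hw := D.weight_pos k l
    set T := D.sym k l * (M * (R ^ k * S ^ l) * D.weight k l) with hT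
    have hT0 : 0 < T := by positivity
    refine le_of_mul_le_mul_left (a := D.sym k l) ?_ hsym
    rw [D.sym_mul_sol hk]
    have t1 : (if k = 1 ∧ l = D.l₀ then D.A else 0) ≤ T / 3 := by
      split_ifs with h
      · obtain ⟨rfl, rfl⟩ := h
        have : T / 3 = D.A * (R ^ 1 * S ^ D.l₀) := by
          rw [hT, hM]; field_simp
        rw [this]
        refine le_mul_of_one_le_right hA.le (one_le_mul_of_one_le_of_one_le ?_ (one_le_pow₀ hS1))
        exact one_le_pow₀ hR1
      · positivity
    have t2 : (if D.p ≤ l then D.B * ((k : ℝ) ^ D.h * D.g (l - D.p) * D.sol k (l - D.p)) else 0)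
        ≤ T / 3 := by
      split_ifs with h
      · have hg := D.g_nonneg (l - D.p)
        have hSp : 3 * D.B * K₁ ≤ S ^ D.p := by
          have : S ^ 1 ≤ S ^ D.p := pow_le_pow_right₀ hS1 hp
          rw [pow_one] at this
          linarith
        have hSl : S ^ l = S ^ (l - D.p) * S ^ D.p := by rw [← pow_add, Nat.sub_add_cancel h]
        calc D.B * ((k : ℝ) ^ D.h * D.g (l - D.p) * D.sol k (l - D.p))
            ≤ D.B * ((k : ℝ) ^ D.h * D.g (l - D.p)
              * (M * (R ^ k * S ^ (l - D.p)) * D.weight k (l - D.p))) := by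
              have := ihB h
              gcongr
          _ = D.B * M * (R ^ k * S ^ (l - D.p))
              * ((k : ℝ) ^ D.h * D.g (l - D.p) * D.weight k (l - D.p)) := by ring
          _ ≤ D.B * M * (R ^ k * S ^ (l - D.p)) * (K₁ * D.sym k l * D.weight k l) := by
              have := h₁ k l hk h
              gcongr
          _ = (3 * D.B * K₁) * (M * (R ^ k * S ^ (l - D.p)) * D.sym k l * D.weight k l) / 3 := by
              ring
          _ ≤ S ^ D.p * (M * (R ^ k * S ^ (l - D.p)) * D.sym k l * D.weight k l) / 3 := by
              gcongr
          _ = T / 3 := by rw [hT, hSl]; ring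
      · positivity
    have t3 : (if D.q ≤ k ∧ D.μ ≤ l then D.C * (((k - D.q : ℕ) : ℝ) ^ D.j
        * ((l - D.μ + D.α).descFactorial D.α : ℝ) * D.sol (k - D.q) (l - D.μ + D.α)) else 0)
        ≤ T / 3 := by
      split_ifs with h
      · have hih := ihC h.1 h.2
        obtain ⟨k', rfl⟩ := Nat.exists_eq_add_of_le' h.1
        have hl : l - D.μ + D.α = l + D.δ := by have := D.δ_add; omega
        rw [Nat.add_sub_cancel, hl] at hih ⊢
        -- The shift estimate is available only from k ≥ 1; at k = 0 the coefficients vanish.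
        rcases Nat.eq_zero_or_pos k' with rfl | hk'
        · rw [sol_zero]
          simp only [mul_zero]
          positivity
        have hRq : 3 * D.C * K₂ * S ^ D.δ ≤ R ^ D.q := by
          have : R ^ 1 ≤ R ^ D.q := pow_le_pow_right₀ hR1 hq
          rw [pow_one] at this
          linarith
        calc D.C * ((k' : ℝ) ^ D.j * ((l + D.δ).descFactorial D.α : ℝ) * D.sol k' (l + D.δ))
            ≤ D.C * ((k' : ℝ) ^ D.j * ((l + D.δ).descFactorial D.α : ℝ)
              * (M * (R ^ k' * S ^ (l + D.δ)) * D.weight k' (l + D.δ))) := by gcongr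
          _ = D.C * M * (R ^ k' * S ^ (l + D.δ)) * ((k' : ℝ) ^ D.j
              * ((l + D.δ).descFactorial D.α : ℝ) * D.weight k' (l + D.δ)) := by ring
          _ ≤ D.C * M * (R ^ k' * S ^ (l + D.δ))
              * (K₂ * D.sym (k' + D.q) l * D.weight (k' + D.q) l) := by
              have := h₂ k' l hk'
              gcongr
          _ = (3 * D.C * K₂ * S ^ D.δ)
              * (M * (R ^ k' * S ^ l) * D.sym (k' + D.q) l * D.weight (k' + D.q) l) / 3 := by
              rw [pow_add]; ring
          _ ≤ R ^ D.q
              * (M * (R ^ k' * S ^ l) * D.sym (k' + D.q) l * D.weight (k' + D.q) l) / 3 := by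
              gcongr
          _ = T / 3 := by rw [hT, pow_add]; ring
      · positivity
    linarith
  refine ⟨M, R * S, hM0, one_le_mul_of_one_le_of_one_le hR1 hS1, fun k l => (key k l).trans ?_⟩
  have := D.weight_pos k l
  gcongr
  rw [mul_pow]
  have h1 : R ^ k ≤ R ^ (k + l) := pow_le_pow_right₀ hR1 (by omega)
  have h2 : S ^ l ≤ S ^ (k + l) := pow_le_pow_right₀ hS1 (by omega)
  gcongr

theorem sStar_eq : sStar D.m D.c D.p D.q D.μ D.h D.β D.j D.α
    = 1 + max 0 ((D.j + D.E - D.m) / D.q) := by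
  rw [sStar, E, e, δ, Nat.cast_sub D.μ_lt_α.le]
  congr 3
  ring

theorem sigmaStar_eq : sigmaStar D.m D.c D.p D.h D.β = 1 + D.e := rfl

/-- The coefficients of the solution satisfy the Gevrey estimates of the critical order. -/
theorem exists_sol_le : ∃ M R : ℝ, 0 < M ∧ 1 ≤ R ∧ ∀ k l : ℕ,
    D.sol k l ≤ M * R ^ (k + l)
      * ((k ! : ℝ) ^ (sStar D.m D.c D.p D.q D.μ D.h D.β D.j D.α - 1)
        * (l ! : ℝ) ^ (sigmaStar D.m D.c D.p D.h D.β - 1)) := by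
  obtain ⟨M, R, hM, hR, h⟩ := D.exists_sol_le_weight
  obtain ⟨c, hc, hasc⟩ := exists_ascFactorial_le D.α
  have hb := D.E_div_nonneg
  have hαR : (0 : ℝ) < D.α := by exact_mod_cast D.α_pos
  have hqR : (0 : ℝ) < D.q := by exact_mod_cast D.q_pos
  set b := D.E / (D.α * D.q) with hbdef
  refine ⟨M, R * c ^ b, hM, one_le_mul_of_one_le_of_one_le hR (Real.one_le_rpow hc hb),
    fun k l => (h k l).trans ?_⟩
  have hf1 : (1 : ℝ) ≤ (k ! : ℝ) := by exact_mod_cast Nat.factorial_pos k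
  have hf0 : (0 : ℝ) < (k ! : ℝ) := by linarith
  have hw : D.weight k l ≤ (c ^ b) ^ (k + l)
      * ((k ! : ℝ) ^ (sStar D.m D.c D.p D.q D.μ D.h D.β D.j D.α - 1)
        * (l ! : ℝ) ^ (sigmaStar D.m D.c D.p D.h D.β - 1)) := by
    rw [weight, sStar_eq, sigmaStar_eq, add_sub_cancel_left, add_sub_cancel_left, ← mul_assoc]
    refine mul_le_mul_of_nonneg_right ?_ (by positivity)
    have h1 : (((l + 1).ascFactorial (D.α * k) : ℕ) : ℝ) ^ b
        ≤ (c ^ b) ^ (k + l) * (k ! : ℝ) ^ (D.α * b) := by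
      refine (Real.rpow_le_rpow (by positivity) (hasc k l) hb).trans (le_of_eq ?_)
      rw [Real.mul_rpow (by positivity) (by positivity), ← Real.rpow_natCast, ← Real.rpow_natCast,
        ← Real.rpow_natCast, ← Real.rpow_mul (by linarith), ← Real.rpow_mul (by linarith),
        ← Real.rpow_mul (by linarith : 0 ≤ c), mul_comm b]
    calc (k ! : ℝ) ^ (-(((D.m : ℝ) - D.j) / D.q))
          * (((l + 1).ascFactorial (D.α * k) : ℕ) : ℝ) ^ b
        ≤ (k ! : ℝ) ^ (-(((D.m : ℝ) - D.j) / D.q))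
          * ((c ^ b) ^ (k + l) * (k ! : ℝ) ^ (D.α * b)) := by gcongr
      _ = (c ^ b) ^ (k + l) * (k ! : ℝ) ^ (-(((D.m : ℝ) - D.j) / D.q) + D.α * b) := by
          rw [Real.rpow_add hf0]; ring
      _ ≤ _ := by
          gcongr
          -- Since αb = E/q, the exponents add up to (j+E-m)/q; because k! ≥ 1 it may be replaced by
          -- its positive part.
          refine le_trans (le_of_eq ?_) (le_max_right _ _)
          rw [hbdef]
          field_simp
          ring
  calc M * R ^ (k + l) * D.weight k l
      ≤ M * R ^ (k + l) * ((c ^ b) ^ (k + l)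
        * ((k ! : ℝ) ^ (sStar D.m D.c D.p D.q D.μ D.h D.β D.j D.α - 1)
        * (l ! : ℝ) ^ (sigmaStar D.m D.c D.p D.h D.β - 1))) := by gcongr
    _ = _ := by rw [mul_pow]; ring

end Model

/-! ### Growth comparisons for the lower bound. -/

/-- From log r ≤ r^{1-κ}/(1-κ) one gets n log r ≤ r/(1-κ). Thus O(r^κ) factors that are powers of r
contribute only geometrically. -/
theorem exists_natCast_pow_le {κ : ℝ} (hκ : κ < 1) : ∃ G : ℝ, 1 ≤ G ∧
    ∀ r n : ℕ, 1 ≤ r → (n : ℝ) ≤ (r : ℝ) ^ κ → (r : ℝ) ^ n ≤ G ^ r := by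
  have hε : 0 < 1 - κ := by linarith
  refine ⟨Real.exp (1 / (1 - κ)), Real.one_le_exp (by positivity), fun r n hr hn => ?_⟩
  have hr0 : (0 : ℝ) < r := by exact_mod_cast hr
  have hlog : 0 ≤ Real.log r := Real.log_natCast_nonneg r
  rw [← Real.exp_nat_mul, ← Real.rpow_natCast, Real.rpow_def_of_pos hr0, Real.exp_le_exp]
  calc Real.log r * n ≤ Real.log r * (r : ℝ) ^ κ := by gcongr
    _ ≤ (r : ℝ) ^ (1 - κ) / (1 - κ) * (r : ℝ) ^ κ := by
      have := Real.log_le_rpow_div hr0.le hε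
      gcongr
    _ = (r : ℝ) ^ (1 - κ) * (r : ℝ) ^ κ / (1 - κ) := by ring
    _ = r * (1 / (1 - κ)) := by
      rw [← Real.rpow_add hr0, sub_add_cancel, Real.rpow_one]
      ring

theorem natCast_le_of_le_rpow {κ : ℝ} (hκ : κ < 1) {r n : ℕ} (hr : 1 ≤ r)
    (hn : (n : ℝ) ≤ (r : ℝ) ^ κ) : n ≤ r := by
  have h1 : (1 : ℝ) ≤ r := by exact_mod_cast hr
  have h2 : (r : ℝ) ^ κ ≤ (r : ℝ) ^ (1 : ℝ) := Real.rpow_le_rpow_of_exponent_le h1 hκ.le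
  rw [Real.rpow_one] at h2
  exact_mod_cast hn.trans h2

/-- Shows that the initial climb to k ~ r^κ loses at most a geometric factor, even when every step
is estimated crudely by b/r^m. -/
theorem exists_pow_le_div_pow {κ b : ℝ} (hκ : κ < 1) (hb : 0 < b) (m N : ℕ) : ∃ c : ℝ, 0 < c ∧
    ∀ r n : ℕ, 1 ≤ r → (n : ℝ) ≤ (r : ℝ) ^ κ → c ^ r ≤ (b / (r : ℝ) ^ m) ^ (N * n) := by
  obtain ⟨G, hG, h⟩ := exists_natCast_pow_le hκ
  have hb1 : 0 < min b 1 := lt_min hb one_pos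
  have hG0 : 0 < G := by linarith
  refine ⟨min b 1 ^ N / G ^ (m * N), by positivity, fun r n hr hn => ?_⟩
  have hr0 : (0 : ℝ) < r := by exact_mod_cast hr
  have hnr := natCast_le_of_le_rpow hκ hr hn
  have h1 : (min b 1 ^ N) ^ r ≤ b ^ (N * n) := by
    rw [← pow_mul]
    calc min b 1 ^ (N * r) ≤ min b 1 ^ (N * n) :=
          pow_le_pow_of_le_one hb1.le (min_le_right _ _) (Nat.mul_le_mul_left _ hnr)
      _ ≤ b ^ (N * n) := by
          gcongr
          exact min_le_left _ _
  have h2 : ((r : ℝ) ^ m) ^ (N * n) ≤ (G ^ (m * N)) ^ r := by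
    calc ((r : ℝ) ^ m) ^ (N * n) = ((r : ℝ) ^ n) ^ (m * N) := by
          rw [← pow_mul, ← pow_mul]
          congr 1
          ring
      _ ≤ (G ^ r) ^ (m * N) := by
          gcongr
          exact h r n hr hn
      _ = _ := by rw [← pow_mul, ← pow_mul, mul_comm]
  rw [div_pow, div_pow]
  gcongr

/-- The argument x is at most Ar, so x! ≤ (Ar)^x; in r^x the parts r^a and r^{bn} are geometric, and
only r^{Nr} matters. -/
theorem exists_factorial_le_pow {κ : ℝ} (hκ : κ < 1) (a b N : ℕ) : ∃ Z : ℝ, 1 ≤ Z ∧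
    ∀ r n : ℕ, 1 ≤ r → (n : ℝ) ≤ (r : ℝ) ^ κ →
      ((a + b * n + N * r)! : ℝ) ≤ Z ^ r * (r : ℝ) ^ (N * r) := by
  obtain ⟨G, hG, h⟩ := exists_natCast_pow_le hκ
  set A : ℕ := a + b + N + 1 with hA
  have hA1 : (1 : ℝ) ≤ (A : ℝ) := by exact_mod_cast (by omega : 1 ≤ A)
  refine ⟨(A : ℝ) ^ A * Real.exp 1 ^ a * G ^ b, ?_, fun r n hr hn => ?_⟩
  · exact one_le_mul_of_one_le_of_one_le (one_le_mul_of_one_le_of_one_le (one_le_pow₀ hA1)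
      (one_le_pow₀ (Real.one_le_exp zero_le_one))) (one_le_pow₀ hG)
  have hr1 : (1 : ℝ) ≤ r := by exact_mod_cast hr
  have hnr := natCast_le_of_le_rpow hκ hr hn
  set x := a + b * n + N * r with hx
  have hxA : x ≤ A * r := by
    have h1 : b * n ≤ b * r := Nat.mul_le_mul_left _ hnr
    have h2 : a ≤ a * r := Nat.le_mul_of_pos_right _ hr
    have h3 : A * r = a * r + b * r + N * r + r := by rw [hA]; ring
    omega
  have hxA' : (x : ℝ) ≤ A * r := by exact_mod_cast hxA
  have h1 : (x ! : ℝ) ≤ (x : ℝ) ^ x := by exact_mod_cast Nat.factorial_le_pow x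
  have hre : (r : ℝ) ≤ Real.exp 1 ^ r := by
    rw [← Real.exp_nat_mul, mul_one]
    linarith [Real.add_one_le_exp (r : ℝ)]
  calc (x ! : ℝ) ≤ (A * r : ℝ) ^ x := h1.trans (by gcongr)
    _ = (A : ℝ) ^ x * ((r : ℝ) ^ a * ((r : ℝ) ^ n) ^ b * (r : ℝ) ^ (N * r)) := by
      rw [mul_pow, ← pow_mul, ← pow_add, ← pow_add, mul_comm n b]
    _ ≤ (A : ℝ) ^ (A * r) * ((Real.exp 1 ^ r) ^ a * (G ^ r) ^ b * (r : ℝ) ^ (N * r)) := by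
      have := h r n hr hn
      gcongr
    _ = _ := by
      rw [mul_pow, mul_pow, ← pow_mul, ← pow_mul, ← pow_mul, ← pow_mul, ← pow_mul, mul_comm a,
        mul_comm b]
      ring

theorem pow_le_factorial_mul (N r : ℕ) (hN : 1 ≤ N) :
    ((r : ℝ) / Real.exp 1) ^ (N * r) ≤ ((N * r)! : ℝ) := by
  have h1 := Real.pow_div_factorial_le_exp ((N * r : ℕ) : ℝ) (by positivity) (N * r)
  have hf : (0 : ℝ) < ((N * r)! : ℝ) := by exact_mod_cast Nat.factorial_pos _
  have hre : (r : ℝ) ≤ ((N * r : ℕ) : ℝ) := by exact_mod_cast Nat.le_mul_of_pos_left r hN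
  rw [div_le_iff₀ hf] at h1
  rw [div_pow, div_le_iff₀ (by positivity), ← Real.exp_nat_mul, mul_one, mul_comm ((N * r)! : ℝ)]
  exact le_trans (by gcongr) h1

/-- Comparison of the orders of growth of two sequences. -/
theorem le_of_pow_mul_rpow_le {c Z θ θ' : ℝ} (hc : 0 < c)
    (h : ∀ r : ℕ, 1 ≤ r → c ^ r * (r : ℝ) ^ (θ * r) ≤ Z ^ r * (r : ℝ) ^ (θ' * r))
    (hZ : 0 < Z) : θ ≤ θ' := by
  by_contra hlt
  push Not at hlt
  have hlim : Filter.Tendsto (fun r : ℕ => (r : ℝ) ^ (θ - θ')) Filter.atTop Filter.atTop :=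
    (tendsto_rpow_atTop (by linarith)).comp tendsto_natCast_atTop_atTop
  obtain ⟨r, hr1, hr⟩ := ((Filter.eventually_ge_atTop 1).and
    (hlim.eventually_gt_atTop (Z / c))).exists
  have hr0 : (0 : ℝ) < r := by exact_mod_cast hr1
  have h1 := h r hr1
  rw [Real.rpow_mul hr0.le, Real.rpow_mul hr0.le, Real.rpow_natCast, Real.rpow_natCast, ← mul_pow,
    ← mul_pow] at h1
  have h2 := le_of_pow_le_pow_left₀ (by omega) (by positivity) h1
  rw [Real.rpow_sub hr0, div_lt_div_iff₀ hc (by positivity)] at hr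
  linarith

/-! ### Lower bounds for the coefficients along a path. -/

namespace Model

variable (D : Model)

theorem sym_mono {k k' l l' : ℕ} (hk : k ≤ k') (hl : l ≤ l') : D.sym k l ≤ D.sym k' l' := by
  have hkR : (k : ℝ) ≤ k' := by exact_mod_cast hk
  rw [sym_eq, sym_eq]
  refine add_le_add (by gcongr) (Finset.sum_le_sum fun v hv => ?_)
  have h1 : (l.descFactorial v.2 : ℝ) ≤ (l'.descFactorial v.2 : ℝ) := by
    exact_mod_cast Nat.descFactorial_le _ hl
  have := neg_nonneg.2 (D.c_nonpos v hv)
  gcongr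

/-- The sum of the absolute values of the coefficients of `L`. -/
def coeffSum : ℝ := 1 + ∑ v ∈ Im D.m, -D.c v

theorem coeffSum_pos : 0 < D.coeffSum := by
  have := Finset.sum_nonneg fun v hv => neg_nonneg.2 (D.c_nonpos v hv)
  unfold coeffSum
  linarith

/-- An upper bound of the symbol along the curve `k ~ l ^ κ`. -/
theorem sym_le_of_linear_le {κ M a ρ : ℝ} (ha : 1 ≤ a) (hρ : 1 ≤ ρ)
    (hM : ∀ v ∈ Lam0 D.m D.c, κ * v.1 + v.2 ≤ M) {k l : ℕ} (hk : (k : ℝ) ≤ a * ρ ^ κ)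
    (hl : (l : ℝ) ≤ a * ρ) : D.sym k l ≤ D.coeffSum * a ^ D.m * ρ ^ M := by
  have hρ0 : 0 < ρ := by linarith
  have hterm : ∀ v ∈ Lam0 D.m D.c, v.1 + v.2 ≤ D.m →
      (k : ℝ) ^ v.1 * (l : ℝ) ^ v.2 ≤ a ^ D.m * ρ ^ M := by
    intro v hv hvm
    calc (k : ℝ) ^ v.1 * (l : ℝ) ^ v.2 ≤ (a * ρ ^ κ) ^ v.1 * (a * ρ) ^ v.2 := by gcongr
      _ = a ^ (v.1 + v.2) * ρ ^ (κ * v.1 + v.2) := by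
        rw [mul_pow, mul_pow, pow_add, Real.rpow_add hρ0, Real.rpow_mul hρ0.le, Real.rpow_natCast,
          Real.rpow_natCast]
        ring
      _ ≤ a ^ D.m * ρ ^ M := by
        have := hM v hv
        gcongr
  have h0 : (k : ℝ) ^ D.m ≤ a ^ D.m * ρ ^ M := by
    simpa using hterm (D.m, 0) (Or.inl rfl) (by simp)
  rw [sym_eq, coeffSum, mul_assoc, add_mul, one_mul, Finset.sum_mul]
  refine add_le_add h0 (Finset.sum_le_sum fun v hv => ?_)
  by_cases hcv : D.c v = 0
  · simp [hcv]
  · refine mul_le_mul_of_nonneg_left ?_ (neg_nonneg.2 (D.c_nonpos v hv))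
    have hd : (l.descFactorial v.2 : ℝ) ≤ (l : ℝ) ^ v.2 := by
      exact_mod_cast Nat.descFactorial_le_pow _ _
    refine le_trans ?_ (hterm v (Or.inr ⟨hv, hcv⟩) (mem_Im.1 (show (v.1, v.2) ∈ Im D.m from hv)).2)
    gcongr

/-- The case κ = 1 of the preceding estimate: every exponent in Λ₀ has total degree at most m. -/
theorem sym_le_pow {a ρ : ℝ} (ha : 1 ≤ a) (hρ : 1 ≤ ρ) {k l : ℕ} (hk : (k : ℝ) ≤ a * ρ)
    (hl : (l : ℝ) ≤ a * ρ) : D.sym k l ≤ D.coeffSum * a ^ D.m * ρ ^ D.m := by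
  have := D.sym_le_of_linear_le (κ := 1) (M := D.m) ha hρ (fun v hv => ?_) (by simpa using hk) hl
  · simpa using this
  · have h1 : v.1 + v.2 ≤ D.m := by
      rcases hv with rfl | ⟨hv, -⟩
      · simp
      · exact (mem_Im.1 (show (v.1, v.2) ∈ Im D.m from hv)).2
    rw [one_mul]
    exact_mod_cast h1

theorem β_le : D.β ≤ D.m := by have := (mem_Im.1 D.hβ_mem).2; omega

/-- Iteration of the term in `B`. -/
theorem sol_iterate_x {k l N : ℕ} {Y : ℝ} (hk : 1 ≤ k) (hl : D.m ≤ l)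
    (hY : D.sym k (l + D.p * N) ≤ Y) :
    D.sol k l * (D.B * (k : ℝ) ^ D.h) ^ N * (N ! : ℝ) ^ D.β ≤ Y ^ N * D.sol k (l + D.p * N) := by
  have hB := D.B_pos
  have hY0 : 0 < Y := (D.sym_pos hk _).trans_le hY
  induction N with
  | zero => simp
  | succ N ih =>
    have hmono : D.sym k (l + D.p * N) ≤ D.sym k (l + D.p * (N + 1)) :=
      D.sym_mono le_rfl (by rw [mul_add]; omega)
    have h1 := ih (hmono.trans hY)
    have h2 := D.sol_step_x (l := l + D.p * N) hk
    rw [add_assoc, ← Nat.mul_succ] at h2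
    have hs := D.sol_nonneg k (l + D.p * (N + 1))
    have hs' := D.sol_nonneg k (l + D.p * N)
    have hg : ((N : ℝ) + 1) ^ D.β ≤ D.g (l + D.p * N) := by
      refine le_trans ?_ (D.descFactorial_le_g _)
      -- Because l ≥ m ≥ β, the smallest factor l+pN+1-β is at least N+1.
      have h3 : (N + 1) ^ D.β ≤ (l + D.p * N).descFactorial D.β := by
        refine (Nat.pow_le_pow_left ?_ _).trans (Nat.pow_sub_le_descFactorial _ _)
        have h4 := D.β_le
        have h5 : N ≤ D.p * N := Nat.le_mul_of_pos_left N D.p_pos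
        omega
      exact_mod_cast h3
    calc D.sol k l * (D.B * (k : ℝ) ^ D.h) ^ (N + 1) * (((N + 1)! : ℕ) : ℝ) ^ D.β
        = (D.sol k l * (D.B * (k : ℝ) ^ D.h) ^ N * (N ! : ℝ) ^ D.β)
          * (D.B * (k : ℝ) ^ D.h) * ((N : ℝ) + 1) ^ D.β := by
          rw [Nat.factorial_succ]
          push_cast
          rw [mul_pow ((N : ℝ) + 1)]
          ring
      _ ≤ (Y ^ N * D.sol k (l + D.p * N)) * (D.B * (k : ℝ) ^ D.h) * D.g (l + D.p * N) := by
          gcongr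
      _ = Y ^ N * (D.B * ((k : ℝ) ^ D.h * D.g (l + D.p * N) * D.sol k (l + D.p * N))) := by ring
      _ ≤ Y ^ N * (D.sym k (l + D.p * (N + 1)) * D.sol k (l + D.p * (N + 1))) := by gcongr
      _ ≤ Y ^ N * (Y * D.sol k (l + D.p * (N + 1))) := by gcongr
      _ = _ := by ring

/-- The induction adds the last t-step, the one landing at l, and so runs over all l. Here Y bounds
the symbol at the corner with both the largest k and the largest l, hence at every point of the path
by monotonicity. -/
theorem sol_iterate_t_aux {k N : ℕ} {Y : ℝ} (hk : 1 ≤ k) (l : ℕ) (hl : D.μ ≤ l)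
    (hY : D.sym (k + D.q * N) (l + D.δ * N) ≤ Y) :
    D.sol k (l + D.δ * N) * D.C ^ N * (N ! : ℝ) ^ D.j
      * (((l - D.μ + 1).ascFactorial N : ℕ) : ℝ) ^ D.α ≤ Y ^ N * D.sol (k + D.q * N) l := by
  have hC := D.C_pos
  have hY0 : 0 < Y := (D.sym_pos (by omega) _).trans_le hY
  induction N generalizing l with
  | zero => simp
  | succ N ih =>
    have e1 : l + D.δ + D.δ * N = l + D.δ * (N + 1) := by ring
    have e2 : k + D.q * N + D.q = k + D.q * (N + 1) := by ring
    have hδ := D.δ_add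
    have hδ' := D.δ_pos
    have hmono : D.sym (k + D.q * N) (l + D.δ + D.δ * N)
        ≤ D.sym (k + D.q * (N + 1)) (l + D.δ * (N + 1)) :=
      D.sym_mono (by omega) e1.le
    have h1 := ih (l + D.δ) (by omega) (hmono.trans hY)
    have h2 := D.sol_step_t (k := k + D.q * N) hl
    rw [e2] at h2
    rw [e1] at h1
    have hs := D.sol_nonneg (k + D.q * (N + 1)) l
    have hs' := D.sol_nonneg (k + D.q * N) (l + D.δ)
    have hs'' := D.sol_nonneg k (l + D.δ * (N + 1))
    have hkN : (N : ℝ) + 1 ≤ ((k + D.q * N : ℕ) : ℝ) := by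
      have h5 : N ≤ D.q * N := Nat.le_mul_of_pos_left N D.q_pos
      exact_mod_cast (by omega : N + 1 ≤ k + D.q * N)
    have hdesc : ((l - D.μ + 1 : ℕ) : ℝ) ^ D.α ≤ ((l + D.δ).descFactorial D.α : ℝ) := by
      have h3 : (l - D.μ + 1) ^ D.α ≤ (l + D.δ).descFactorial D.α := by
        refine le_trans (le_of_eq ?_) (Nat.pow_sub_le_descFactorial _ _)
        congr 1
        omega
      exact_mod_cast h3
    have hasc : (((l - D.μ + 1).ascFactorial (N + 1) : ℕ) : ℝ)
        ≤ ((l - D.μ + 1 : ℕ) : ℝ) * (((l + D.δ - D.μ + 1).ascFactorial N : ℕ) : ℝ) := by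
      have h3 : (l - D.μ + 1).ascFactorial (N + 1)
          ≤ (l - D.μ + 1) * (l + D.δ - D.μ + 1).ascFactorial N := by
        rw [Nat.ascFactorial_succ, ← Nat.succ_ascFactorial]
        exact Nat.mul_le_mul_left _ (Nat.ascFactorial_le _ (by omega))
      exact_mod_cast h3
    set a₁ := (((l + D.δ - D.μ + 1).ascFactorial N : ℕ) : ℝ) with ha₁
    calc D.sol k (l + D.δ * (N + 1)) * D.C ^ (N + 1) * (((N + 1)! : ℕ) : ℝ) ^ D.j
          * (((l - D.μ + 1).ascFactorial (N + 1) : ℕ) : ℝ) ^ D.α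
        ≤ D.sol k (l + D.δ * (N + 1)) * D.C ^ (N + 1) * (((N + 1)! : ℕ) : ℝ) ^ D.j
          * (((l - D.μ + 1 : ℕ) : ℝ) * a₁) ^ D.α := by gcongr
      _ = (D.sol k (l + D.δ * (N + 1)) * D.C ^ N * (N ! : ℝ) ^ D.j * a₁ ^ D.α)
          * D.C * ((N : ℝ) + 1) ^ D.j * ((l - D.μ + 1 : ℕ) : ℝ) ^ D.α := by
          rw [Nat.factorial_succ]
          push_cast
          rw [mul_pow ((N : ℝ) + 1), mul_pow _ a₁]
          ring
      _ ≤ (Y ^ N * D.sol (k + D.q * N) (l + D.δ)) * D.C * ((k + D.q * N : ℕ) : ℝ) ^ D.j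
          * ((l + D.δ).descFactorial D.α : ℝ) := by gcongr
      _ = Y ^ N * (D.C * (((k + D.q * N : ℕ) : ℝ) ^ D.j * ((l + D.δ).descFactorial D.α : ℝ)
          * D.sol (k + D.q * N) (l + D.δ))) := by ring
      _ ≤ Y ^ N * (D.sym (k + D.q * (N + 1)) l * D.sol (k + D.q * (N + 1)) l) := by gcongr
      _ ≤ Y ^ N * (Y * D.sol (k + D.q * (N + 1)) l) := by
          have := (D.sym_mono le_rfl (Nat.le_add_right l (D.δ * (N + 1)))).trans hY
          gcongr
      _ = _ := by ring

/-- Iteration of the term in `C`. -/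
theorem sol_iterate_t {k l N : ℕ} {Y : ℝ} (hk : 1 ≤ k) (hl : D.μ ≤ l)
    (hY : D.sym (k + D.q * N) (l + D.δ * N) ≤ Y) :
    D.sol k (l + D.δ * N) * D.C ^ N * (N ! : ℝ) ^ (D.j + D.α) ≤ Y ^ N * D.sol (k + D.q * N) l := by
  refine le_trans ?_ (D.sol_iterate_t_aux hk l hl hY)
  have hC := D.C_pos
  have hs := D.sol_nonneg k (l + D.δ * N)
  have h1 : (N ! : ℝ) ≤ (((l - D.μ + 1).ascFactorial N : ℕ) : ℝ) := by
    rw [← Nat.one_ascFactorial]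
    exact_mod_cast Nat.ascFactorial_le _ (by omega)
  rw [pow_add, ← mul_assoc]
  gcongr

/-- Some coefficient `u_{1,l}` with `l ≥ m` is positive. -/
theorem exists_sol_pos : ∃ l, D.m ≤ l ∧ 0 < D.sol 1 l := by
  obtain ⟨r, hr, hg⟩ := D.exists_reach
  have hB := D.B_pos
  refine ⟨_, hr, ?_⟩
  have key : ∀ i ≤ r, 0 < D.sol 1 (D.l₀ + D.p * i) := by
    intro i hi
    induction i with
    | zero =>
      rw [mul_zero, add_zero]
      exact pos_of_mul_pos_right (D.A_pos.trans_le D.A_le_sym_mul_sol) (D.sym_pos le_rfl _).le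
    | succ i ih =>
      have h1 := ih (by omega)
      have h2 := D.sol_step_x (l := D.l₀ + D.p * i) le_rfl
      have h3 := hg i (by omega)
      rw [add_assoc, ← Nat.mul_succ] at h2
      refine pos_of_mul_pos_right (lt_of_lt_of_le ?_ h2) (D.sym_pos le_rfl _).le
      simp only [Nat.cast_one, one_pow, one_mul]
      positivity
  exact key r le_rfl

end Model

theorem mul_div_pow_le {x b f Y y : ℝ} {N : ℕ} (hY : 0 < Y) (h : x * b ^ N * f ≤ Y ^ N * y) :
    x * (b / Y) ^ N * f ≤ y := by
  have hYN : 0 < Y ^ N := by positivity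
  rw [div_pow, show x * (b ^ N / Y ^ N) * f = x * b ^ N * f / Y ^ N by ring, div_le_iff₀ hYN]
  linarith

theorem one_le_factorial_pow (n a : ℕ) : (1 : ℝ) ≤ (n ! : ℝ) ^ a :=
  one_le_pow₀ (by exact_mod_cast Nat.factorial_pos n)

namespace Model

variable (D : Model)

/-- Lower bounds of the coefficients along a path that first reaches `k ~ r ^ κ` with bounded `l`,
then `l ~ p δ r` with constant `k`, and finally `k ~ q p r` with bounded `l`. -/
theorem exists_lower_bounds : ∃ κ < (1 : ℝ), ∃ (l : ℕ) (n : ℕ → ℕ),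
    (∀ r, 1 ≤ r → (n r : ℝ) ≤ (r : ℝ) ^ κ) ∧
    (∃ c : ℝ, 0 < c ∧ ∀ r : ℕ, 1 ≤ r → c ^ r * (r : ℝ) ^ (D.d * D.δ * r)
      ≤ D.sol (1 + D.q * D.p * n r + 0 * r) (l + 0 * n r + D.p * D.δ * r)) ∧
    (∃ c : ℝ, 0 < c ∧ ∀ r : ℕ, 1 ≤ r →
      c ^ r * (r : ℝ) ^ ((D.d * D.δ + D.p * (D.j + D.α - D.m)) * r)
        ≤ D.sol (1 + D.q * D.p * n r + D.q * D.p * r) (l + 0 * n r + 0 * r)) := by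
  obtain ⟨κ, hκ0, hκ1, hκ⟩ := D.exists_support
  obtain ⟨l, hml, hs0⟩ := D.exists_sol_pos
  have hB := D.B_pos
  have hC := D.C_pos
  have hp := D.p_pos
  have hδ := D.δ_pos
  have hμl : D.μ ≤ l := D.μ_lt.le.trans hml
  -- Chosen so that, with n ≤ r, both indices stay below ar on the entire path; the doubled qp
  -- accounts for the two rounds of t-steps.
  set a : ℝ := ((1 + 2 * (D.q * D.p) + l + 2 * (D.p * D.δ) : ℕ) : ℝ) with ha
  have ha1 : 1 ≤ a := by
    rw [ha]
    exact_mod_cast (by omega : 1 ≤ 1 + 2 * (D.q * D.p) + l + 2 * (D.p * D.δ))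
  set y : ℝ := D.coeffSum * a ^ D.m with hy
  have hy0 : 0 < y := by
    have := D.coeffSum_pos
    positivity
  obtain ⟨c₁, hc₁, h₁⟩ := exists_pow_le_div_pow hκ1 (div_pos hB hy0) D.m D.δ
  obtain ⟨c₂, hc₂, h₂⟩ := exists_pow_le_div_pow hκ1 (div_pos hC hy0) D.m D.p
  set n : ℕ → ℕ := fun r => ⌊(r : ℝ) ^ κ⌋₊ with hn
  have hnle : ∀ r, 1 ≤ r → (n r : ℝ) ≤ (r : ℝ) ^ κ := fun r _ =>
    Nat.floor_le (Real.rpow_nonneg (Nat.cast_nonneg r) κ)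
  have hlt : ∀ r : ℕ, (r : ℝ) ^ κ ≤ n r + 1 := fun r => (Nat.lt_floor_add_one _).le
  have hnr : ∀ r, 1 ≤ r → n r ≤ r := fun r hr => natCast_le_of_le_rpow hκ1 hr (hnle r hr)
  have hsym : ∀ r, 1 ≤ r → ∀ k' l' : ℕ, k' ≤ 1 + D.q * D.p * n r + D.q * D.p * r →
      l' ≤ l + D.p * D.δ * r → D.sym k' l' ≤ y * (r : ℝ) ^ D.m := by
    intro r hr k' l' hk' hl'
    have h1 : D.q * D.p * n r ≤ D.q * D.p * r := Nat.mul_le_mul_left _ (hnr r hr)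
    have h2 : l ≤ l * r := Nat.le_mul_of_pos_right _ hr
    have h3 : (1 + 2 * (D.q * D.p) + l + 2 * (D.p * D.δ)) * r
        = r + 2 * (D.q * D.p * r) + l * r + 2 * (D.p * D.δ * r) := by ring
    refine D.sym_le_pow ha1 (by exact_mod_cast hr) ?_ ?_
    · rw [ha]
      exact_mod_cast (by omega : k' ≤ (1 + 2 * (D.q * D.p) + l + 2 * (D.p * D.δ)) * r)
    · rw [ha]
      exact_mod_cast (by omega : l' ≤ (1 + 2 * (D.q * D.p) + l + 2 * (D.p * D.δ)) * r)
  -- the first part of the path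
  set c₃ : ℝ := min (D.sol 1 l) 1 * c₁ * c₂ with hc₃def
  have hmin : 0 < min (D.sol 1 l) 1 := lt_min hs0 one_pos
  have hc₃ : 0 < c₃ := by positivity
  have h₃ : ∀ r : ℕ, 1 ≤ r → c₃ ^ r ≤ D.sol (1 + D.q * (D.p * n r)) l := by
    intro r hr
    have hr0 : (0 : ℝ) < r := by exact_mod_cast hr
    have hY : 0 < y * (r : ℝ) ^ D.m := by positivity
    have h1 : D.δ * (D.p * n r) ≤ D.p * D.δ * r := by
      rw [← mul_assoc, mul_comm D.δ]
      exact Nat.mul_le_mul_left _ (hnr r hr)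
    -- The numbers of steps, δn in x and pn in t, are matched so that l returns exactly to its
    -- starting value.
    have e1 : D.p * (D.δ * n r) = D.δ * (D.p * n r) := by ring
    have hx := mul_div_pow_le hY (D.sol_iterate_x (k := 1) (N := D.δ * n r) le_rfl hml
      (hsym r hr _ _ (by omega) (by rw [e1]; omega)))
    have ht := mul_div_pow_le hY (D.sol_iterate_t (k := 1) (N := D.p * n r) le_rfl hμl
      (hsym r hr _ _ (by rw [← mul_assoc]; omega) (by omega)))
    rw [e1, Nat.cast_one, one_pow, mul_one, ← div_div] at hx
    rw [← div_div] at ht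
    have hmr : min (D.sol 1 l) 1 ^ r ≤ D.sol 1 l :=
      (pow_le_of_le_one hmin.le (min_le_right _ _) (by omega)).trans (min_le_left _ _)
    have hx' : min (D.sol 1 l) 1 ^ r * c₁ ^ r ≤ D.sol 1 (l + D.δ * (D.p * n r)) := by
      refine le_trans ?_ hx
      have := h₁ r (n r) hr (hnle r hr)
      refine le_trans ?_ (le_mul_of_one_le_right (by positivity) (one_le_factorial_pow _ _))
      gcongr
    rw [hc₃def, mul_pow, mul_pow]
    refine le_trans ?_ ht
    have := h₂ r (n r) hr (hnle r hr)
    have hs := D.sol_nonneg 1 (l + D.δ * (D.p * n r))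
    refine le_trans ?_ (le_mul_of_one_le_right (by positivity) (one_le_factorial_pow _ _))
    gcongr
  -- the second part of the path
  set b₁ : ℝ := D.B / y / Real.exp 1 ^ D.β with hb₁
  have hb₁0 : 0 < b₁ := by positivity
  have h₄ : ∀ r : ℕ, 1 ≤ r → (c₃ * b₁ ^ D.δ) ^ r * (r : ℝ) ^ (D.d * D.δ * r)
      ≤ D.sol (1 + D.q * (D.p * n r)) (l + D.p * (D.δ * r)) := by
    intro r hr
    have hr0 : (0 : ℝ) < r := by exact_mod_cast hr
    have hr1 : (1 : ℝ) ≤ r := by exact_mod_cast hr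
    set K := 1 + D.q * (D.p * n r) with hK
    -- Here the supporting line enters: with K of order r^κ and l = O(r), the symbol is smaller by
    -- r^d than the numerator K^h r^β.
    have hYκ : D.sym K (l + D.p * (D.δ * r)) ≤ y * (r : ℝ) ^ (κ * D.h + D.β - D.d) := by
      refine D.sym_le_of_linear_le ha1 hr1 hκ ?_ ?_
      · have h1 : 1 ≤ (r : ℝ) ^ κ := Real.one_le_rpow hr1 hκ0
        have h2 : (K : ℝ) ≤ (1 + D.q * D.p) * (r : ℝ) ^ κ := by
          have h4 := mul_le_mul_of_nonneg_left (hnle r hr)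
            (by positivity : (0 : ℝ) ≤ D.q * D.p)
          rw [hK]
          push_cast
          linarith
        refine h2.trans ?_
        have h3 : (1 + D.q * D.p : ℝ) ≤ a := by
          rw [ha]
          exact_mod_cast (by omega : 1 + D.q * D.p ≤ 1 + 2 * (D.q * D.p) + l + 2 * (D.p * D.δ))
        gcongr
      · have h2 : l ≤ l * r := Nat.le_mul_of_pos_right _ hr
        have h3 : (1 + 2 * (D.q * D.p) + l + 2 * (D.p * D.δ)) * r
            = r + 2 * (D.q * D.p * r) + l * r + 2 * (D.p * (D.δ * r)) := by ring
        rw [ha]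
        exact_mod_cast (by omega : l + D.p * (D.δ * r)
          ≤ (1 + 2 * (D.q * D.p) + l + 2 * (D.p * D.δ)) * r)
    have hx := mul_div_pow_le (by positivity)
      (D.sol_iterate_x (k := K) (N := D.δ * r) (by omega) hml hYκ)
    refine le_trans ?_ hx
    have hKκ : (r : ℝ) ^ (κ * D.h) ≤ (K : ℝ) ^ D.h := by
      rw [Real.rpow_mul hr0.le, Real.rpow_natCast]
      have h1 : n r ≤ D.q * (D.p * n r) := by
        rw [← mul_assoc]
        exact Nat.le_mul_of_pos_left _ (Nat.mul_pos D.q_pos hp)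
      have h2 : ((n r : ℝ) + 1) ≤ K := by exact_mod_cast (by omega : n r + 1 ≤ K)
      have := (hlt r).trans h2
      gcongr
    have hfac : (((r : ℝ) / Real.exp 1) ^ D.β) ^ (D.δ * r) ≤ ((D.δ * r)! : ℝ) ^ D.β := by
      rw [← pow_mul, mul_comm D.β, pow_mul]
      have := pow_le_factorial_mul D.δ r hδ
      gcongr
    have hsol := h₃ r hr
    -- The net gain per x-step: the exponents κh and β cancel and r^d remains.
    have e1 : D.B * (r : ℝ) ^ (κ * D.h) / (y * (r : ℝ) ^ (κ * D.h + D.β - D.d))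
        * ((r : ℝ) / Real.exp 1) ^ D.β = b₁ * (r : ℝ) ^ D.d := by
      rw [Real.rpow_sub hr0, Real.rpow_add hr0, Real.rpow_natCast, div_pow, hb₁]
      field_simp
    have e2 : (r : ℝ) ^ (D.d * D.δ * r) = ((r : ℝ) ^ D.d) ^ (D.δ * r) := by
      rw [mul_assoc, Real.rpow_mul hr0.le, ← Nat.cast_mul, Real.rpow_natCast]
    calc (c₃ * b₁ ^ D.δ) ^ r * (r : ℝ) ^ (D.d * D.δ * r)
        = c₃ ^ r * (b₁ * (r : ℝ) ^ D.d) ^ (D.δ * r) := by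
          rw [e2, mul_pow, mul_pow, ← pow_mul]
          ring
      _ = c₃ ^ r * (D.B * (r : ℝ) ^ (κ * D.h) / (y * (r : ℝ) ^ (κ * D.h + D.β - D.d))) ^ (D.δ * r)
          * (((r : ℝ) / Real.exp 1) ^ D.β) ^ (D.δ * r) := by
          rw [← e1, mul_pow]
          ring
      _ ≤ _ := by
          have := D.sol_nonneg K l
          gcongr
  -- the third part of the path
  set b₂ : ℝ := D.C / y / Real.exp 1 ^ (D.j + D.α) with hb₂
  have hb₂0 : 0 < b₂ := by positivity
  refine ⟨κ, hκ1, l, n, hnle, ⟨c₃ * b₁ ^ D.δ, by positivity, fun r hr => ?_⟩,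
    ⟨c₃ * b₁ ^ D.δ * b₂ ^ D.p, by positivity, fun r hr => ?_⟩⟩
  · simpa only [zero_mul, add_zero, mul_assoc] using h₄ r hr
  · have hr0 : (0 : ℝ) < r := by exact_mod_cast hr
    have hY : 0 < y * (r : ℝ) ^ D.m := by positivity
    have h4 := h₄ r hr
    have e0 : D.p * (D.δ * r) = D.δ * (D.p * r) := by ring
    rw [e0] at h4
    have ht := mul_div_pow_le hY (D.sol_iterate_t (k := 1 + D.q * (D.p * n r)) (N := D.p * r)
      (by omega) hμl (hsym r hr _ _ (by simp only [mul_assoc]; omega)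
        (by simp only [mul_assoc]; omega)))
    simp only [zero_mul, add_zero, mul_assoc]
    refine le_trans ?_ ht
    have hfac : (((r : ℝ) / Real.exp 1) ^ (D.j + D.α)) ^ (D.p * r)
        ≤ ((D.p * r)! : ℝ) ^ (D.j + D.α) := by
      rw [← pow_mul, mul_comm (D.j + D.α), pow_mul]
      have := pow_le_factorial_mul D.p r hp
      gcongr
    -- The net factor per t-step, with the symbol now estimated only by r^m.
    have e1 : D.C / (y * (r : ℝ) ^ D.m) * ((r : ℝ) / Real.exp 1) ^ (D.j + D.α)
        = b₂ * (r : ℝ) ^ ((D.j : ℝ) + D.α - D.m) := by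
      rw [Real.rpow_sub hr0, ← Nat.cast_add, Real.rpow_natCast, Real.rpow_natCast, div_pow, hb₂]
      field_simp
    have e2 : (r : ℝ) ^ ((D.d * D.δ + D.p * ((D.j : ℝ) + D.α - D.m)) * r)
        = (r : ℝ) ^ (D.d * D.δ * r) * ((r : ℝ) ^ ((D.j : ℝ) + D.α - D.m)) ^ (D.p * r) := by
      rw [add_mul, Real.rpow_add hr0, ← Real.rpow_natCast _ (D.p * r), ← Real.rpow_mul hr0.le]
      push_cast
      ring_nf
    calc (c₃ * (b₁ ^ D.δ * b₂ ^ D.p)) ^ r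
          * (r : ℝ) ^ ((D.d * D.δ + D.p * ((D.j : ℝ) + D.α - D.m)) * r)
        = ((c₃ * b₁ ^ D.δ) ^ r * (r : ℝ) ^ (D.d * D.δ * r))
          * (b₂ * (r : ℝ) ^ ((D.j : ℝ) + D.α - D.m)) ^ (D.p * r) := by
          rw [e2, ← mul_assoc c₃, mul_pow (c₃ * b₁ ^ D.δ), mul_pow b₂, ← pow_mul b₂]
          ring
      _ = ((c₃ * b₁ ^ D.δ) ^ r * (r : ℝ) ^ (D.d * D.δ * r))
          * (D.C / (y * (r : ℝ) ^ D.m)) ^ (D.p * r)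
          * (((r : ℝ) / Real.exp 1) ^ (D.j + D.α)) ^ (D.p * r) := by
          rw [← e1, mul_pow (D.C / _)]
          ring
      _ ≤ _ := by
          have := D.sol_nonneg (1 + D.q * (D.p * n r)) (l + D.δ * (D.p * r))
          gcongr

/-! ### Necessity of the critical orders. -/

/-- Gevrey estimates along sequences of indices of at most linear growth. -/
theorem exists_upper_bound {s σ M R κ : ℝ} (hs : 1 ≤ s) (hσ : 1 ≤ σ) (hM : 0 < M) (hR : 1 ≤ R)
    (hκ : κ < 1) (h : ∀ k l : ℕ, D.sol k l
      ≤ M * R ^ (k + l) * ((k ! : ℝ) ^ (s - 1) * (l ! : ℝ) ^ (σ - 1)))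
    (a b N a' b' N' : ℕ) : ∃ Z : ℝ, 0 < Z ∧ ∀ r n : ℕ, 1 ≤ r → (n : ℝ) ≤ (r : ℝ) ^ κ →
      D.sol (a + b * n + N * r) (a' + b' * n + N' * r)
        ≤ Z ^ r * (r : ℝ) ^ ((N * (s - 1) + N' * (σ - 1)) * r) := by
  obtain ⟨Z₁, hZ₁, h₁⟩ := exists_factorial_le_pow hκ a b N
  obtain ⟨Z₂, hZ₂, h₂⟩ := exists_factorial_le_pow hκ a' b' N'
  have hs' : 0 ≤ s - 1 := by linarith
  have hσ' : 0 ≤ σ - 1 := by linarith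
  have hM1 : 1 ≤ max M 1 := le_max_right _ _
  set A := a + b + N + (a' + b' + N') with hA
  refine ⟨max M 1 * R ^ A * (Z₁ ^ (s - 1) * Z₂ ^ (σ - 1)), by positivity, fun r n hr hn => ?_⟩
  have hr0 : (0 : ℝ) < r := by exact_mod_cast hr
  have hnr := natCast_le_of_le_rpow hκ hr hn
  refine (h _ _).trans ?_
  have hlin : ∀ a b N : ℕ, a + b * n + N * r ≤ (a + b + N) * r := by
    intro a b N
    have h1 : b * n ≤ b * r := Nat.mul_le_mul_left _ hnr
    have h2 : a ≤ a * r := Nat.le_mul_of_pos_right _ hr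
    have h3 : (a + b + N) * r = a * r + b * r + N * r := by ring
    omega
  have t1 : M ≤ max M 1 ^ r := (le_max_left M 1).trans (le_self_pow₀ hM1 (by omega))
  have t2 : R ^ (a + b * n + N * r + (a' + b' * n + N' * r)) ≤ (R ^ A) ^ r := by
    rw [← pow_mul, hA, add_mul]
    exact pow_le_pow_right₀ hR (add_le_add (hlin a b N) (hlin a' b' N'))
  have hrpow : ∀ (Z x : ℝ) (N : ℕ), 1 ≤ Z → (Z ^ r * (r : ℝ) ^ (N * r)) ^ x
      = (Z ^ x) ^ r * (r : ℝ) ^ (N * x * r) := by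
    intro Z x N hZ
    rw [Real.mul_rpow (by positivity) (by positivity), ← Real.rpow_natCast, ← Real.rpow_natCast,
      ← Real.rpow_natCast, ← Real.rpow_mul (by linarith), ← Real.rpow_mul hr0.le,
      ← Real.rpow_mul (by linarith)]
    push_cast
    ring_nf
  have t3 := Real.rpow_le_rpow (by positivity) (h₁ r n hr hn) hs'
  have t4 := Real.rpow_le_rpow (by positivity) (h₂ r n hr hn) hσ'
  rw [hrpow _ _ _ hZ₁] at t3
  rw [hrpow _ _ _ hZ₂] at t4
  calc M * R ^ (a + b * n + N * r + (a' + b' * n + N' * r))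
        * (((a + b * n + N * r)! : ℝ) ^ (s - 1) * ((a' + b' * n + N' * r)! : ℝ) ^ (σ - 1))
      ≤ max M 1 ^ r * (R ^ A) ^ r * (((Z₁ ^ (s - 1)) ^ r * (r : ℝ) ^ (N * (s - 1) * r))
        * ((Z₂ ^ (σ - 1)) ^ r * (r : ℝ) ^ (N' * (σ - 1) * r))) := by gcongr
    _ = _ := by
      rw [add_mul, Real.rpow_add hr0, mul_pow, mul_pow, mul_pow]
      ring

/-- Gevrey estimates of the solution force the critical orders. -/
theorem le_of_gevrey_bound {s σ M R : ℝ} (hs : 1 ≤ s) (hσ : 1 ≤ σ) (hM : 0 < M) (hR : 1 ≤ R)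
    (h : ∀ k l : ℕ, D.sol k l ≤ M * R ^ (k + l) * ((k ! : ℝ) ^ (s - 1) * (l ! : ℝ) ^ (σ - 1))) :
    sStar D.m D.c D.p D.q D.μ D.h D.β D.j D.α ≤ s ∧ sigmaStar D.m D.c D.p D.h D.β ≤ σ := by
  obtain ⟨κ, hκ, l, n, hn, ⟨c₁, hc₁, h₁⟩, ⟨c₂, hc₂, h₂⟩⟩ := D.exists_lower_bounds
  have hpR : (0 : ℝ) < D.p := by exact_mod_cast D.p_pos
  have hqR : (0 : ℝ) < D.q := by exact_mod_cast D.q_pos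
  have hδR : (0 : ℝ) < D.δ := by exact_mod_cast D.δ_pos
  constructor
  · obtain ⟨Z, hZ, hu⟩ := D.exists_upper_bound hs hσ hM hR hκ h 1 (D.q * D.p) (D.q * D.p) l 0 0
    have hle := le_of_pow_mul_rpow_le hc₂
      (fun r hr => (h₂ r hr).trans (hu r (n r) hr (hn r hr))) hZ
    push_cast at hle
    rw [sStar_eq]
    -- Positivity comes from s ≥ 1; the other inequality is that of the growth exponents, divided by
    -- p.
    have hmax : max 0 ((D.j + D.E - D.m) / D.q) ≤ s - 1 := by
      refine max_le (by linarith) ?_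
      rw [div_le_iff₀ hqR]
      have hd : D.d = D.e * D.p := by rw [e, div_mul_cancel₀ _ hpR.ne']
      rw [hd] at hle
      refine le_of_mul_le_mul_right ?_ hpR
      unfold E
      linarith
    linarith
  · obtain ⟨Z, hZ, hu⟩ := D.exists_upper_bound hs hσ hM hR hκ h 1 (D.q * D.p) 0 l 0 (D.p * D.δ)
    have hle := le_of_pow_mul_rpow_le hc₁
      (fun r hr => (h₁ r hr).trans (hu r (n r) hr (hn r hr))) hZ
    push_cast at hle
    rw [sigmaStar_eq, e]
    have hdp : D.d / D.p ≤ σ - 1 := by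
      rw [div_le_iff₀ hpR]
      refine le_of_mul_le_mul_right ?_ hδR
      linarith
    linarith

/-! ### Gevrey classes and coefficient bounds. -/

theorem norm_gevrey_term (s σ : ℝ) (z : ℂ × ℂ) (k l : ℕ) :
    ‖cf D.series k l / ((((k ! : ℝ) ^ (s - 1) * (l ! : ℝ) ^ (σ - 1) : ℝ)) : ℂ)
      * z.1 ^ k * z.2 ^ l‖ = D.sol k l / ((k ! : ℝ) ^ (s - 1) * (l ! : ℝ) ^ (σ - 1))
        * ‖z.1‖ ^ k * ‖z.2‖ ^ l := by
  rw [cf_series, ← Complex.ofReal_div, norm_mul, norm_mul, norm_pow, norm_pow, Complex.norm_real,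
    Real.norm_of_nonneg (div_nonneg (D.sol_nonneg k l) (by positivity))]

theorem gevrey_weight_pos (s σ : ℝ) (k l : ℕ) :
    0 < (k ! : ℝ) ^ (s - 1) * (l ! : ℝ) ^ (σ - 1) := by
  have h1 : (0 : ℝ) < (k ! : ℝ) := by exact_mod_cast Nat.factorial_pos k
  have h2 : (0 : ℝ) < (l ! : ℝ) := by exact_mod_cast Nat.factorial_pos l
  positivity

/-- Summability at one point (ρ, ρ) with 0 < ρ < 1 bounds every term by the sum of the norms, as in
Cauchy's estimates. -/
theorem exists_bound_of_inGevrey {s σ : ℝ} (h : InGevrey s σ D.series) :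
    ∃ M R : ℝ, 0 < M ∧ 1 ≤ R ∧ ∀ k l : ℕ, D.sol k l
      ≤ M * R ^ (k + l) * ((k ! : ℝ) ^ (s - 1) * (l ! : ℝ) ^ (σ - 1)) := by
  have hcont : Continuous fun ρ : ℝ => ((ρ : ℂ), (ρ : ℂ)) := by fun_prop
  have hev := (hcont.tendsto' 0 0 (by simp)).eventually h
  obtain ⟨ρ, hsum, hρ⟩ := ((hev.filter_mono nhdsWithin_le_nhds).and
    (Ioo_mem_nhdsGT (zero_lt_one (α := ℝ)))).exists
  have hρ0 : 0 < ρ := hρ.1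
  have hnn : 0 ≤ ∑' n : ℕ × ℕ, ‖cf D.series n.1 n.2 / (((((n.1)! : ℝ) ^ (s - 1)
      * ((n.2)! : ℝ) ^ (σ - 1) : ℝ)) : ℂ) * (ρ : ℂ) ^ n.1 * (ρ : ℂ) ^ n.2‖ :=
    tsum_nonneg fun _ => norm_nonneg _
  refine ⟨_ + 1, ρ⁻¹, add_pos_of_nonneg_of_pos hnn one_pos, (one_le_inv₀ hρ0).2 hρ.2.le,
    fun k l => ?_⟩
  have h1 := hsum.norm.le_tsum (k, l) fun _ _ => norm_nonneg _
  have hw := gevrey_weight_pos s σ k l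
  have h2 := D.norm_gevrey_term s σ ((ρ : ℂ), (ρ : ℂ)) k l
  simp only [Complex.norm_real, Real.norm_of_nonneg hρ0.le] at h2
  simp only [h2] at h1
  have hpow : 0 < ρ ^ (k + l) := by positivity
  rw [mul_assoc, ← pow_add, div_mul_eq_mul_div, div_le_iff₀ hw] at h1
  rw [inv_pow, mul_assoc, mul_comm (ρ ^ (k + l))⁻¹, ← mul_assoc, ← div_eq_mul_inv, le_div_iff₀ hpow]
  refine h1.trans ?_
  gcongr
  exact (lt_add_one _).le

/-- On the polydisc of radius 1/(2R) the terms are dominated by a product of geometric series of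
ratio 1/2. -/
theorem inGevrey_of_bound {s σ M R : ℝ} (hR : 1 ≤ R)
    (h : ∀ k l : ℕ, D.sol k l ≤ M * R ^ (k + l) * ((k ! : ℝ) ^ (s - 1) * (l ! : ℝ) ^ (σ - 1))) :
    InGevrey s σ D.series := by
  have hR0 : 0 < R := by linarith
  have hball : Metric.ball (0 : ℂ × ℂ) (1 / (2 * R)) ∈ 𝓝 (0 : ℂ × ℂ) :=
    Metric.ball_mem_nhds _ (by positivity)
  filter_upwards [hball] with z hz
  rw [mem_ball_zero_iff, Prod.norm_def, max_lt_iff] at hz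
  have hsum : Summable fun n : ℕ × ℕ => M * ((1 / 2 : ℝ) ^ n.1 * (1 / 2 : ℝ) ^ n.2) :=
    (summable_geometric_two.mul_of_nonneg summable_geometric_two
      (fun _ => by positivity) (fun _ => by positivity)).mul_left M
  refine hsum.of_norm_bounded fun n => ?_
  rw [D.norm_gevrey_term]
  have hw := gevrey_weight_pos s σ n.1 n.2
  have h1 : D.sol n.1 n.2 / ((n.1 ! : ℝ) ^ (s - 1) * (n.2 ! : ℝ) ^ (σ - 1)) ≤ M * R ^ (n.1 + n.2) := by
    rw [div_le_iff₀ hw]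
    exact h _ _
  have h2 : 0 ≤ M * R ^ (n.1 + n.2) :=
    le_trans (div_nonneg (D.sol_nonneg _ _) hw.le) h1
  have hz1 := hz.1.le
  have hz2 := hz.2.le
  calc D.sol n.1 n.2 / ((n.1 ! : ℝ) ^ (s - 1) * (n.2 ! : ℝ) ^ (σ - 1)) * ‖z.1‖ ^ n.1 * ‖z.2‖ ^ n.2
      ≤ M * R ^ (n.1 + n.2) * (1 / (2 * R)) ^ n.1 * (1 / (2 * R)) ^ n.2 := by gcongr
    _ = M * ((1 / 2 : ℝ) ^ n.1 * (1 / 2 : ℝ) ^ n.2) := by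
      have e : 1 / (2 * R) = 1 / 2 * R⁻¹ := by field_simp
      rw [e, mul_pow, mul_pow, pow_add, inv_pow, inv_pow]
      field_simp

theorem inGevrey_iff {s σ : ℝ} (hs : 1 ≤ s) (hσ : 1 ≤ σ) : InGevrey s σ D.series ↔
    sStar D.m D.c D.p D.q D.μ D.h D.β D.j D.α ≤ s ∧ sigmaStar D.m D.c D.p D.h D.β ≤ σ := by
  constructor
  · intro h
    obtain ⟨M, R, hM, hR, hb⟩ := D.exists_bound_of_inGevrey h
    exact D.le_of_gevrey_bound hs hσ hM hR hb
  · rintro ⟨h1, h2⟩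
    obtain ⟨M, R, hM, hR, hb⟩ := D.exists_sol_le
    refine D.inGevrey_of_bound (M := M) hR fun k l => (hb k l).trans ?_
    have hk : (1 : ℝ) ≤ (k ! : ℝ) := by exact_mod_cast Nat.factorial_pos k
    have hl : (1 : ℝ) ≤ (l ! : ℝ) := by exact_mod_cast Nat.factorial_pos l
    gcongr

/-- The complete statement for an equation whose coefficients follow the recurrence of `D`. -/
theorem exists_unique_solution_gevrey {rhs : Series → Series}
    (hrhs : ∀ u k l, cf (rhs u) k l = D.rhsCoeff (cf u) k l) :
    ∃ u : Series, IsFormalSolution D.m D.c rhs u ∧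
      (∀ v : Series, IsFormalSolution D.m D.c rhs v → v = u) ∧
      ∀ s σ : ℝ, 1 ≤ s → 1 ≤ σ → (InGevrey s σ u ↔
        sStar D.m D.c D.p D.q D.μ D.h D.β D.j D.α ≤ s ∧ sigmaStar D.m D.c D.p D.h D.β ≤ σ) :=
  ⟨D.series, D.isFormalSolution_series hrhs, fun _ hv => D.eq_series hrhs hv,
    fun _ _ hs hσ => D.inGevrey_iff hs hσ⟩

end Model

end FormalGevrey

end

/-! ### The two equations as instances of the recurrence. -/

theorem proposition5p6 (m : ℕ) (c : ℕ × ℕ → ℝ) (A B C : ℝ) (p q μ h β j α : ℕ)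
    (hc : ∀ v ∈ FormalGevrey.Im m, c v ≤ 0)
    (hA : 0 < A) (hB : 0 < B) (hC : 0 < C)
    (hp : 1 ≤ p) (hq : 1 ≤ q) (hμ : μ < m)
    (hhβ : (h, β) ∈ FormalGevrey.Im m)
    (hout : ((h : ℝ), (β : ℝ)) ∉ FormalGevrey.newtonPolygon m c)
    (hjα : (j, α) ∈ FormalGevrey.Im m) (hαμ : μ < α) :
    (∃ u : FormalGevrey.Series,
      FormalGevrey.IsFormalSolution m c
        (FormalGevrey.modelRhs m A B C p q μ h β j α) u ∧
      (∀ v : FormalGevrey.Series, FormalGevrey.IsFormalSolution m c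
        (FormalGevrey.modelRhs m A B C p q μ h β j α) v → v = u) ∧
      ∀ s σ : ℝ, 1 ≤ s → 1 ≤ σ →
        (FormalGevrey.InGevrey s σ u ↔
          FormalGevrey.sStar m c p q μ h β j α ≤ s ∧
            FormalGevrey.sigmaStar m c p h β ≤ σ)) ∧
    (∃ u : FormalGevrey.Series,
      FormalGevrey.IsFormalSolution m c
        (FormalGevrey.variantRhs A B C p q μ h β j α) u ∧
      (∀ v : FormalGevrey.Series, FormalGevrey.IsFormalSolution m c
        (FormalGevrey.variantRhs A B C p q μ h β j α) v → v = u) ∧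
      ∀ s σ : ℝ, 1 ≤ s → 1 ≤ σ →
        (FormalGevrey.InGevrey s σ u ↔
          FormalGevrey.sStar m c p q μ h β j α ≤ s ∧
            FormalGevrey.sigmaStar m c p h β ≤ σ)) := by
  constructor
  · let D : FormalGevrey.Model :=
      { m, p, q, μ, h, β, j, α, c, A, B, C
        l₀ := m
        g := fun l => l.descFactorial β
        c_nonpos := hc
        A_pos := hA
        B_pos := hB
        C_pos := hC
        p_pos := hp
        q_pos := hq
        μ_lt := hμ
        hβ_mem := hhβ
        not_mem := hout
        jα_mem := hjα
        μ_lt_α := hαμ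
        descFactorial_le_g := fun l => le_rfl
        g_le_pow := fun l => by exact_mod_cast Nat.descFactorial_le_pow l β
        -- The source already sits at exponent m, so no x-step is needed.
        exists_reach := ⟨0, by simp, by simp⟩ }
    refine D.exists_unique_solution_gevrey fun u k l => ?_
    rw [FormalGevrey.modelRhs, FormalGevrey.cf_add, FormalGevrey.cf_add, FormalGevrey.cf_smul,
      FormalGevrey.cf_smul, FormalGevrey.cf_smul, FormalGevrey.cf_source,
      FormalGevrey.cf_shift_thetaT_fallX, FormalGevrey.cf_shift_thetaT_dx,
      FormalGevrey.Model.rhsCoeff]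
    simp only [mul_ite, mul_one, mul_zero, Complex.ofReal_natCast, D]
  · let D : FormalGevrey.Model :=
      { m, p, q, μ, h, β, j, α, c, A, B, C
        l₀ := 1
        g := fun l => (l : ℝ) ^ β
        c_nonpos := hc
        A_pos := hA
        B_pos := hB
        C_pos := hC
        p_pos := hp
        q_pos := hq
        μ_lt := hμ
        hβ_mem := hhβ
        not_mem := hout
        jα_mem := hjα
        μ_lt_α := hαμ
        descFactorial_le_g := fun l => by exact_mod_cast Nat.descFactorial_le_pow l β
        g_le_pow := fun l => le_rfl
        -- From exponent 1, m x-steps reach 1+pm ≥ m; none is blocked because ordinary powers of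
        -- positive integers are positive, whereas falling factorials may vanish.
        exists_reach := ⟨m, by nlinarith, fun i _ => by positivity⟩ }
    refine D.exists_unique_solution_gevrey fun u k l => ?_
    rw [FormalGevrey.variantRhs, ← pow_one FormalGevrey.xvar, FormalGevrey.cf_add,
      FormalGevrey.cf_add, FormalGevrey.cf_smul, FormalGevrey.cf_smul, FormalGevrey.cf_smul,
      FormalGevrey.cf_source, pow_one, FormalGevrey.cf_shift_thetaT_thetaX,
      FormalGevrey.cf_shift_thetaT_dx, FormalGevrey.Model.rhsCoeff]
    simp only [mul_ite, mul_one, mul_zero, Complex.ofReal_pow, Complex.ofReal_natCast, D]
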